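/- Let $k$ be a field, $G$ an abelian group, and $V=kx_1\oplus kx_2$ a diagram of type $A_2$: a crossed (Yetter–Drinfeld) $kG$-module with coaction $\delta(x_i)=g_i\otimes x_i$ and action $gx_i=\chi_i(g)x_i$, where $g_i\in G$ and $\chi_i:G\to k^\times$ are characters with $\chi_1(g_1)=\chi_2(g_2)=q$, $\chi_2(g_1)\chi_1(g_2)=q^{-1}$, and $q$ a primitive root of unity of order $N\ge 2$. Let $R$ be the tensor algebra of $V$ modulo the quantum Serre relations $(\mathrm{ad}\,x_i)^2(x_j)=0$ for $i\ne j$, where $\mathrm{ad}\,x_i(y)=x_iy-(g_iy)x_i$. It is a braided Hopf algebra in the category of crossed $kG$-modules, with $x_1,x_2$ primitive; let $\varepsilon$ be its counit. Put $e_{12}=x_1$, $e_{23}=x_2$, $e_{13}=x_1x_2-\chi_2(g_1)x_2x_1$ and $z_{ij}=e_{ij}^N$, and let $K\subset R$ be the subalgebra generated by $z_{12},z_{13},z_{23}$. Then $K$ is a braided Hopf subalgebra of $R$ and a $K$-bimodule coalgebra retract of $R$. More precisely, there is a unique linear map $u_2:R\to K$ such that $$u_2(e_{12}^m e_{13}^n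 e_{23}^l\, z)=\varepsilon(e_{12}^m e_{13}^n e_{23}^l)\,z+\delta_{l,m}\,\delta_{N,m+n}\,(1-q^{-1})^{n-N}\,\chi_1(g_2)^{\binom n2-\binom N2}\,z_{13}z$$ for all $0\le m,n,l<N$ and $z\in K$. This $u_2$ is a map of $K$-bimodules, of coalgebras and of crossed $kG$-modules, and it restricts to the identity on $K$. It is a deformation of the naive retraction $u(e_{12}^m e_{13}^n e_{23}^l z)=\varepsilon(e_{12}^m e_{13}^n e_{23}^l)z$. -/

import Mathlib

open scoped TensorProduct

noncomputable section

/-- An algebra `X` in the category of crossed (that is, Yetter–Drinfeld) `kG`-modules over an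
abelian group `G`: an action of `G` by algebra endomorphisms and a coaction of `kG`
that is an algebra map, compatible with each other. (Since `G` is abelian,
the compatibility condition `δ(h x) = h x₋₁ h⁻¹ ⊗ h x₀` reads `δ(h x) = x₋₁ ⊗ h x₀`.) -/
structure CrossedAlgebra (k G X : Type*) [Field k] [CommGroup G] [Ring X] [Algebra k X] where
  act : G →* (X →ₐ[k] X)
  coact : X →ₐ[k] MonoidAlgebra k G ⊗[k] X
  coact_coassoc : ∀ x, TensorProduct.assoc k _ _ _
      ((Coalgebra.comul (R := k) (A := MonoidAlgebra k G)).rTensor X (coact x))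
        = coact.toLinearMap.lTensor (MonoidAlgebra k G) (coact x)
  coact_counit : ∀ x,
    (Coalgebra.counit (R := k) (A := MonoidAlgebra k G)).rTensor X (coact x) = 1 ⊗ₜ[k] x
  coact_act : ∀ h x,
    coact (act h x) = (act h).toLinearMap.lTensor (MonoidAlgebra k G) (coact x)

namespace CrossedAlgebra

variable {k G X : Type*} [Field k] [CommGroup G] [Ring X] [Algebra k X] (C : CrossedAlgebra k G X)

/-- The action of `G` as a linear map `kG ⊗ X → X`. -/
def actLin : MonoidAlgebra k G ⊗[k] X →ₗ[k] X :=
  TensorProduct.lift (MonoidAlgebra.lift k (Module.End k X) G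
    { toFun := fun h => (C.act h).toLinearMap
      map_one' := by rw [map_one]; rfl
      map_mul' := fun a b => by rw [map_mul]; rfl }).toLinearMap

/-- The braiding `c : X ⊗ X → X ⊗ X`, `c(x ⊗ y) = x₋₁ y ⊗ x₀`. -/
def braiding : X ⊗[k] X →ₗ[k] X ⊗[k] X :=
  C.actLin.rTensor X
    ∘ₗ (TensorProduct.assoc k (MonoidAlgebra k G) X X).symm.toLinearMap
    ∘ₗ (TensorProduct.comm k X X).toLinearMap.lTensor (MonoidAlgebra k G)
    ∘ₗ (TensorProduct.assoc k (MonoidAlgebra k G) X X).toLinearMap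
    ∘ₗ C.coact.toLinearMap.rTensor X

/-- The multiplication `(m ⊗ m)(1 ⊗ c ⊗ 1)` of the braided tensor product algebra `X ⊗ X`. -/
def braidedMul : (X ⊗[k] X) ⊗[k] (X ⊗[k] X) →ₗ[k] X ⊗[k] X :=
  TensorProduct.map (LinearMap.mul' k X) (LinearMap.mul' k X)
    ∘ₗ (TensorProduct.assoc k X X (X ⊗[k] X)).symm.toLinearMap
    ∘ₗ ((TensorProduct.assoc k X X X).toLinearMap
        ∘ₗ C.braiding.rTensor X
        ∘ₗ (TensorProduct.assoc k X X X).symm.toLinearMap).lTensor X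
    ∘ₗ (TensorProduct.assoc k X X (X ⊗[k] X)).toLinearMap

/-- The codiagonal coaction `x ⊗ y ↦ x₋₁ y₋₁ ⊗ (x₀ ⊗ y₀)` of `kG` on `X ⊗ X`. -/
def tensorCoact : X ⊗[k] X →ₗ[k] MonoidAlgebra k G ⊗[k] (X ⊗[k] X) :=
  (LinearMap.mul' k (MonoidAlgebra k G)).rTensor (X ⊗[k] X)
    ∘ₗ (TensorProduct.tensorTensorTensorComm k (MonoidAlgebra k G) X
        (MonoidAlgebra k G) X).toLinearMap
    ∘ₗ TensorProduct.map C.coact.toLinearMap C.coact.toLinearMap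

lemma braiding_tmul {h : G} {b : X} (hb : C.coact b = MonoidAlgebra.single h (1 : k) ⊗ₜ[k] b)
    (c : X) : C.braiding (b ⊗ₜ c) = C.act h c ⊗ₜ b := by
  simp [braiding, hb, actLin]

lemma braidedMul_tmul {h : G} {b : X}
    (hb : C.coact b = MonoidAlgebra.single h (1 : k) ⊗ₜ[k] b) (a c d : X) :
    C.braidedMul ((a ⊗ₜ b) ⊗ₜ (c ⊗ₜ d)) = (a * C.act h c) ⊗ₜ (b * d) := by
  simp [braidedMul, C.braiding_tmul hb]

lemma tensorCoact_tmul {h h' : G} {a b : X}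
    (ha : C.coact a = MonoidAlgebra.single h (1 : k) ⊗ₜ[k] a)
    (hb : C.coact b = MonoidAlgebra.single h' (1 : k) ⊗ₜ[k] b) :
    C.tensorCoact (a ⊗ₜ b) = MonoidAlgebra.single (h * h') (1 : k) ⊗ₜ (a ⊗ₜ b) := by
  simp [tensorCoact, ha, hb]

end CrossedAlgebra

/-- A braided Hopf algebra in the category of crossed `kG`-modules: an algebra and a coalgebra
in this category whose comultiplication and counit are algebra maps, where
`X ⊗ X` is the braided tensor product algebra, together with an antipode. -/
structure BraidedHopfAlgebra (k G X : Type*) [Field k] [CommGroup G] [Ring X] [Algebra k X]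
    [Coalgebra k X] extends CrossedAlgebra k G X where
  comul_act : ∀ h x, Coalgebra.comul (R := k) (act h x)
    = TensorProduct.map (act h).toLinearMap (act h).toLinearMap (Coalgebra.comul (R := k) x)
  counit_act : ∀ h x, Coalgebra.counit (R := k) (act h x) = Coalgebra.counit (R := k) x
  comul_coact : ∀ x, toCrossedAlgebra.tensorCoact (Coalgebra.comul (R := k) x)
    = (Coalgebra.comul (R := k) (A := X)).lTensor (MonoidAlgebra k G) (coact x)
  counit_coact : ∀ x, (Coalgebra.counit (R := k) (A := X)).lTensor (MonoidAlgebra k G) (coact x)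
    = 1 ⊗ₜ[k] Coalgebra.counit (R := k) x
  comul_one : Coalgebra.comul (R := k) (1 : X) = 1 ⊗ₜ[k] 1
  comul_mul : ∀ x y : X, Coalgebra.comul (R := k) (x * y)
    = toCrossedAlgebra.braidedMul (Coalgebra.comul (R := k) x ⊗ₜ[k] Coalgebra.comul (R := k) y)
  counit_one : Coalgebra.counit (R := k) (1 : X) = 1
  counit_mul : ∀ x y : X, Coalgebra.counit (R := k) (x * y)
    = Coalgebra.counit (R := k) x * Coalgebra.counit (R := k) y
  antipode : X →ₗ[k] X
  mul_antipode_rTensor_comul : ∀ x : X,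
    LinearMap.mul' k X (antipode.rTensor X (Coalgebra.comul (R := k) x))
      = algebraMap k X (Coalgebra.counit (R := k) x)
  mul_antipode_lTensor_comul : ∀ x : X,
    LinearMap.mul' k X (antipode.lTensor X (Coalgebra.comul (R := k) x))
      = algebraMap k X (Coalgebra.counit (R := k) x)

namespace BraidedHopfAlgebra

/-- The canonical map `P ⊗ P → X ⊗ X`. -/
abbrev inclTensor {k X : Type*} [Field k] [Ring X] [Algebra k X] (P : Subalgebra k X) :
    P ⊗[k] P →ₗ[k] X ⊗[k] X :=
  TensorProduct.map P.val.toLinearMap P.val.toLinearMap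

lemma inclTensor_injective {k X : Type*} [Field k] [Ring X] [Algebra k X] (P : Subalgebra k X) :
    Function.Injective (inclTensor P) :=
  TensorProduct.map_injective_of_flat_flat _ _ Subtype.val_injective Subtype.val_injective

variable {k G X : Type*} [Field k] [CommGroup G] [Ring X] [Algebra k X] [Coalgebra k X]
  (H : BraidedHopfAlgebra k G X) (P : Subalgebra k X)

/-- A subalgebra `P` of a braided Hopf algebra `X` is a (braided) Hopf subalgebra if it is a crossed
submodule with `Δ(P) ⊆ P ⊗ P` and `S(P) ⊆ P`. -/
structure IsHopfSubalgebra : Prop where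
  act_mem : ∀ h, ∀ x ∈ P, H.act h x ∈ P
  coact_mem : ∀ x ∈ P,
    H.coact x ∈ LinearMap.range (P.val.toLinearMap.lTensor (MonoidAlgebra k G))
  comul_mem : ∀ x ∈ P, Coalgebra.comul (R := k) x ∈ LinearMap.range (inclTensor P)
  antipode_mem : ∀ x ∈ P, H.antipode x ∈ P

variable {H P}

/-- The comultiplication of a Hopf subalgebra is the restriction of the one of `X`. -/
def IsHopfSubalgebra.comul (hP : H.IsHopfSubalgebra P) : P →ₗ[k] P ⊗[k] P :=
  (LinearEquiv.ofInjective _ (inclTensor_injective P)).symm.toLinearMap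
    ∘ₗ (Coalgebra.comul (R := k) (A := X) ∘ₗ P.val.toLinearMap).codRestrict
        (LinearMap.range (inclTensor P)) fun x => hP.comul_mem x x.2

lemma IsHopfSubalgebra.inclTensor_comul (hP : H.IsHopfSubalgebra P) (x : P) :
    inclTensor P (hP.comul x) = Coalgebra.comul (R := k) (x : X) := by
  have := LinearEquiv.ofInjective_symm_apply (h := inclTensor_injective P) (inclTensor P)
    ((Coalgebra.comul (R := k) (A := X) ∘ₗ P.val.toLinearMap).codRestrict
        (LinearMap.range (inclTensor P)) (fun x => hP.comul_mem x x.2) x)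
  exact this

lemma IsHopfSubalgebra.incl_assoc_comul (hP : H.IsHopfSubalgebra P) (w : P ⊗[k] P) :
    TensorProduct.map P.val.toLinearMap (inclTensor P)
        ((TensorProduct.assoc k P P P).toLinearMap (hP.comul.rTensor P w))
      = (TensorProduct.assoc k X X X).toLinearMap
        ((Coalgebra.comul (R := k) (A := X)).rTensor X (inclTensor P w)) := by
  have aux : ∀ (u : P ⊗[k] P) (b : P), TensorProduct.map P.val.toLinearMap (inclTensor P)
      ((TensorProduct.assoc k P P P).toLinearMap (u ⊗ₜ b))
        = (TensorProduct.assoc k X X X).toLinearMap (inclTensor P u ⊗ₜ (b : X)) := by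
    intro u b
    induction u with
    | zero => simp only [TensorProduct.zero_tmul, map_zero]
    | tmul c d => rfl
    | add u v hu hv => simp only [TensorProduct.add_tmul, map_add, hu, hv]
  induction w with
  | zero => simp only [map_zero]
  | tmul a b =>
    rw [LinearMap.rTensor_tmul, aux, hP.inclTensor_comul]
    rfl
  | add u v hu hv => simp only [map_add, hu, hv]

lemma IsHopfSubalgebra.incl_lTensor_comul (hP : H.IsHopfSubalgebra P) (w : P ⊗[k] P) :
    TensorProduct.map P.val.toLinearMap (inclTensor P) (hP.comul.lTensor P w)
      = (Coalgebra.comul (R := k) (A := X)).lTensor X (inclTensor P w) := by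
  induction w with
  | zero => simp
  | tmul a b => simp [hP.inclTensor_comul]
  | add u v hu hv => simp only [map_add, hu, hv]

/-- The coalgebra structure of a Hopf subalgebra. -/
@[reducible] def IsHopfSubalgebra.coalgebra (hP : H.IsHopfSubalgebra P) : Coalgebra k P where
  comul := hP.comul
  counit := Coalgebra.counit (R := k) (A := X) ∘ₗ P.val.toLinearMap
  coassoc := by
    refine LinearMap.ext fun x => TensorProduct.map_injective_of_flat_flat
      P.val.toLinearMap (inclTensor P) Subtype.val_injective (inclTensor_injective P) ?_
    simp only [LinearMap.comp_apply]
    rw [hP.incl_assoc_comul, hP.incl_lTensor_comul, hP.inclTensor_comul,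
      ← Coalgebra.coassoc_apply]
    rfl
  rTensor_counit_comp_comul := by
    refine LinearMap.ext fun x => Module.Flat.lTensor_preserves_injective_linearMap (M := k)
      P.val.toLinearMap Subtype.val_injective ?_
    have key : ∀ w : P ⊗[k] P, P.val.toLinearMap.lTensor k
        ((Coalgebra.counit (R := k) (A := X) ∘ₗ P.val.toLinearMap).rTensor P w)
          = (Coalgebra.counit (R := k) (A := X)).rTensor X (inclTensor P w) := by
      intro w
      induction w with
      | zero => simp
      | tmul a b => simp
      | add u v hu hv => simp only [map_add, hu, hv]
    rw [LinearMap.comp_apply, key, hP.inclTensor_comul, Coalgebra.rTensor_counit_comul]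
    simp
  lTensor_counit_comp_comul := by
    refine LinearMap.ext fun x => Module.Flat.rTensor_preserves_injective_linearMap (M := k)
      P.val.toLinearMap Subtype.val_injective ?_
    have key : ∀ w : P ⊗[k] P, P.val.toLinearMap.rTensor k
        ((Coalgebra.counit (R := k) (A := X) ∘ₗ P.val.toLinearMap).lTensor P w)
          = (Coalgebra.counit (R := k) (A := X)).lTensor X (inclTensor P w) := by
      intro w
      induction w with
      | zero => simp
      | tmul a b => simp
      | add u v hu hv => simp only [map_add, hu, hv]
    rw [LinearMap.comp_apply, key, hP.inclTensor_comul, Coalgebra.lTensor_counit_comul]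
    simp

/-- `u : X → P` exhibits the Hopf subalgebra `P` as a `P`-bimodule coalgebra retract of `X` (in the
category of crossed `kG`-modules): it is a coalgebra map, a retraction of the
inclusion `P → X`, a map of `P`-bimodules, and a map of crossed `kG`-modules. -/
structure IsBimoduleCoalgebraRetraction (hP : H.IsHopfSubalgebra P) (u : X →ₗ[k] P) : Prop where
  map_incl : ∀ z : P, u z = z
  map_mul_left : ∀ (z : P) (x : X), u (z * x) = z * u x
  map_mul_right : ∀ (z : P) (x : X), u (x * z) = u x * z
  map_comul : ∀ x, hP.coalgebra.comul (u x)
    = TensorProduct.map u u (Coalgebra.comul (R := k) x)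
  map_counit : ∀ x, hP.coalgebra.counit (u x) = Coalgebra.counit (R := k) x
  map_act : ∀ h x, (u (H.act h x) : X) = H.act h (u x)
  map_coact : ∀ x, H.coact (u x) = (P.val.toLinearMap ∘ₗ u).lTensor (MonoidAlgebra k G) (H.coact x)

end BraidedHopfAlgebra

/-- A diagram of type `A₂` over the field `k` and the abelian group `G`: the diagonal crossed
`kG`-module `V = k x₀ ⊕ k x₁` with coaction `δ(xᵢ) = gᵢ ⊗ xᵢ` and action `g xᵢ = χᵢ(g) xᵢ`, where
`χᵢ(gᵢ) = q` is a primitive root of unity of order `N ≥ 2` and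
`χ₁(g₀) χ₀(g₁) = q⁻¹`. (The two vertices are numbered `0` and `1`.) -/
structure DiagramA2 (k G : Type*) [Field k] [CommGroup G] where
  N : ℕ
  two_le_N : 2 ≤ N
  q : k
  q_primitive : IsPrimitiveRoot q N
  g : Fin 2 → G
  χ : Fin 2 → (G →* kˣ)
  χ_self : ∀ i, (χ i (g i) : k) = q
  χ_mul : (χ 1 (g 0) : k) * (χ 0 (g 1) : k) = q⁻¹

namespace DiagramA2

variable {k G : Type*} [Field k] [CommGroup G] (D : DiagramA2 k G)

/-- The matrix of braiding coefficients `q_{ij} = χ_j(g_i)`. -/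
def qm (i j : Fin 2) : k := (D.χ j (D.g i) : k)

lemma q_ne_zero : D.q ≠ 0 := by
  intro h
  have := D.q_primitive.pow_eq_one
  rw [h, zero_pow (by have := D.two_le_N; omega)] at this
  exact zero_ne_one this

lemma qm_self (i : Fin 2) : D.qm i i = D.q := D.χ_self i

lemma qm_mul {i j : Fin 2} (h : i ≠ j) : D.q * D.qm i j * D.qm j i = 1 := by
  have h1 := D.χ_mul
  have h2 : D.q * D.q⁻¹ = 1 := mul_inv_cancel₀ D.q_ne_zero
  fin_cases i <;> fin_cases j <;> simp_all [qm] <;> linear_combination h2 + D.q * h1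

/-- The action of `G` on the tensor algebra of `V`, by algebra endomorphisms. -/
def freeAct (h : G) : FreeAlgebra k (Fin 2) →ₐ[k] FreeAlgebra k (Fin 2) :=
  FreeAlgebra.lift k fun i => (D.χ i h : k) • FreeAlgebra.ι k i

/-- The braided adjoint action `ad xᵢ (y) = xᵢ y - (gᵢ y) xᵢ` on the tensor algebra of `V`. -/
def freeAd (i : Fin 2) (y : FreeAlgebra k (Fin 2)) : FreeAlgebra k (Fin 2) :=
  FreeAlgebra.ι k i * y - D.freeAct (D.g i) y * FreeAlgebra.ι k i

/-- The quantum Serre relations `(ad xᵢ)² (xⱼ) = 0`, for `i ≠ j`. -/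
inductive SerreRel : FreeAlgebra k (Fin 2) → FreeAlgebra k (Fin 2) → Prop
  | serre (i j : Fin 2) : i ≠ j → SerreRel (D.freeAd i (D.freeAd i (FreeAlgebra.ι k j))) 0

/-- The algebra `R(V)`: the tensor algebra of `V` modulo the quantum Serre relations. -/
def R : Type _ := RingQuot D.SerreRel

instance : Ring D.R := inferInstanceAs (Ring (RingQuot D.SerreRel))
instance : Algebra k D.R := inferInstanceAs (Algebra k (RingQuot D.SerreRel))

/-- The simple root vectors `xᵢ` of `R(V)`. -/
def x (i : Fin 2) : D.R := RingQuot.mkAlgHom k D.SerreRel (FreeAlgebra.ι k i)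

/-- The expanded quantum Serre expression in a family of elements of an algebra. -/
def serreExpr {A : Type*} [Ring A] [Algebra k A] (a : Fin 2 → A) (i j : Fin 2) : A :=
  a i * (a i * a j) - ((1 + D.q) * D.qm i j) • (a i * (a j * a i))
    + (D.q * D.qm i j ^ 2) • (a j * (a i * a i))

lemma map_serre {A : Type*} [Ring A] [Algebra k A] (f : FreeAlgebra k (Fin 2) →ₐ[k] A)
    (i j : Fin 2) : f (D.freeAd i (D.freeAd i (FreeAlgebra.ι k j)))
      = D.serreExpr (fun l => f (FreeAlgebra.ι k l)) i j := by
  have h1 := D.χ_self i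
  simp only [freeAd, freeAct, map_sub, map_mul, FreeAlgebra.lift_ι_apply, map_smul, h1, serreExpr,
    qm, mul_sub, sub_mul, smul_mul_assoc, mul_smul_comm, mul_assoc]
  module

/-- The universal property of `R(V)`. -/
def liftR {A : Type*} [Ring A] [Algebra k A] (a : Fin 2 → A)
    (h : ∀ i j, i ≠ j → D.serreExpr a i j = 0) : D.R →ₐ[k] A :=
  RingQuot.liftAlgHom k ⟨FreeAlgebra.lift k a, by
    rintro _ _ ⟨i, j, hij⟩
    rw [map_serre, map_zero, ← h i j hij]
    simp only [FreeAlgebra.lift_ι_apply]⟩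

@[simp] lemma liftR_x {A : Type*} [Ring A] [Algebra k A] (a : Fin 2 → A)
    (h : ∀ i j, i ≠ j → D.serreExpr a i j = 0) (i : Fin 2) : D.liftR a h (D.x i) = a i := by
  unfold liftR x
  erw [RingQuot.liftAlgHom_mkAlgHom_apply]
  simp

lemma serre_x {i j : Fin 2} (h : i ≠ j) : D.serreExpr D.x i j = 0 := by
  have h1 : RingQuot.mkAlgHom k D.SerreRel (D.freeAd i (D.freeAd i (FreeAlgebra.ι k j))) = 0 := by
    rw [RingQuot.mkAlgHom_rel k (SerreRel.serre i j h), map_zero]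
  rw [map_serre] at h1
  exact h1

/-- The monomials in `x₀` and `x₁` span `R(V)`. -/
lemma R_induction {p : D.R → Prop} (add : ∀ a b, p a → p b → p (a + b))
    (smul : ∀ (c : k) a, p a → p (c • a)) (one : p 1)
    (mul : ∀ i r, p r → p (D.x i * r)) (r : D.R) : p r := by
  obtain ⟨y, rfl⟩ := RingQuot.mkAlgHom_surjective k D.SerreRel r
  let π : FreeAlgebra k (Fin 2) →ₐ[k] D.R := RingQuot.mkAlgHom k D.SerreRel
  suffices H : ∀ y : FreeAlgebra k (Fin 2), ∀ r : D.R, p r → p (π y * r) by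
    have := H y 1 one
    rwa [mul_one] at this
  intro y
  induction y using FreeAlgebra.induction with
  | grade0 c =>
    intro r hr
    rw [AlgHom.commutes]
    have := smul c r hr
    rw [Algebra.smul_def] at this
    exact this
  | grade1 i => intro r hr; exact mul i r hr
  | mul a b ha hb =>
    intro r hr
    rw [map_mul]
    have := ha _ (hb r hr)
    rw [← mul_assoc] at this
    exact this
  | add a b ha hb =>
    intro r hr
    rw [map_add]
    have := add _ _ (ha r hr) (hb r hr)
    rw [← add_mul] at this
    exact this

lemma algHom_ext_R {A : Type*} [Ring A] [Algebra k A] {f f' : D.R →ₐ[k] A}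
    (h : ∀ i, f (D.x i) = f' (D.x i)) : f = f' := by
  ext r
  induction r using D.R_induction with
  | add a b ha hb => rw [map_add, map_add, ha, hb]
  | smul c a ha => rw [map_smul, map_smul, ha]
  | one => rw [map_one, map_one]
  | mul i r hr => rw [map_mul, map_mul, h, hr]

/-- The action of `G` on `R(V)` by algebra endomorphisms, `h xᵢ = χᵢ(h) xᵢ`. -/
def act : G →* (D.R →ₐ[k] D.R) where
  toFun h := D.liftR (fun i => (D.χ i h : k) • D.x i) (by
    intro i j hij
    have := congrArg (fun z => ((D.χ i h : k) * (D.χ i h : k) * (D.χ j h : k)) • z) (D.serre_x hij)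
    simp only [serreExpr, smul_zero] at this
    rw [← this]
    simp only [serreExpr, smul_mul_assoc, mul_smul_comm]
    module)
  map_one' := D.algHom_ext_R fun i => by simp
  map_mul' a b := D.algHom_ext_R fun i => by simp [smul_smul, mul_comm]

@[simp] lemma act_x (h : G) (i : Fin 2) : D.act h (D.x i) = (D.χ i h : k) • D.x i := by
  simp [act]

/-- The coaction of `kG` on `R(V)`, which is an algebra map with `δ(xᵢ) = gᵢ ⊗ xᵢ`. -/
def coact : D.R →ₐ[k] MonoidAlgebra k G ⊗[k] D.R :=
  D.liftR (fun i => MonoidAlgebra.single (D.g i) (1 : k) ⊗ₜ[k] D.x i) (by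
    intro i j hij
    have := congrArg (fun z => MonoidAlgebra.single (D.g i * D.g i * D.g j) (1 : k) ⊗ₜ[k] z)
      (D.serre_x hij)
    simp only [serreExpr, TensorProduct.tmul_zero] at this
    rw [← this]
    have e1 : D.g i * (D.g j * D.g i) = D.g i * D.g i * D.g j := by
      rw [mul_assoc, mul_comm (D.g j)]
    have e2 : D.g j * (D.g i * D.g i) = D.g i * D.g i * D.g j := mul_comm _ _
    have e3 : D.g i * (D.g i * D.g j) = D.g i * D.g i * D.g j := by rw [mul_assoc]
    simp only [serreExpr, Algebra.TensorProduct.tmul_mul_tmul, MonoidAlgebra.single_mul_single,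
      mul_one, e1, e2, e3, TensorProduct.tmul_add, TensorProduct.tmul_sub, TensorProduct.tmul_smul])

@[simp] lemma coact_x (i : Fin 2) :
    D.coact (D.x i) = MonoidAlgebra.single (D.g i) (1 : k) ⊗ₜ[k] D.x i := by
  simp [coact]

/-- Left multiplication by `xᵢ ⊗ 1 + 1 ⊗ xᵢ` in the braided tensor product algebra `R ⊗ R`, that is,
the map `a ⊗ b ↦ xᵢ a ⊗ b + gᵢ a ⊗ xᵢ b`. -/
def primMul (i : Fin 2) : Module.End k (D.R ⊗[k] D.R) :=
  TensorProduct.map (LinearMap.mulLeft k (D.x i)) LinearMap.id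
    + TensorProduct.map (D.act (D.g i)).toLinearMap (LinearMap.mulLeft k (D.x i))

@[simp] lemma primMul_tmul (i : Fin 2) (a b : D.R) : D.primMul i (a ⊗ₜ b)
    = (D.x i * a) ⊗ₜ b + D.act (D.g i) a ⊗ₜ (D.x i * b) := by
  simp [primMul]

lemma act_x_qm (i j : Fin 2) : D.act (D.g i) (D.x j) = D.qm i j • D.x j := by
  simp [qm]

lemma serre_mul {i j : Fin 2} (h : i ≠ j) (a : D.R) :
    D.x i * (D.x i * (D.x j * a)) = ((1 + D.q) * D.qm i j) • (D.x i * (D.x j * (D.x i * a)))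
      - (D.q * D.qm i j ^ 2) • (D.x j * (D.x i * (D.x i * a))) := by
  have := congrArg (fun z => z * a) (D.serre_x h)
  simp only [serreExpr, add_mul, sub_mul, smul_mul_assoc, mul_assoc, zero_mul] at this
  rw [← sub_eq_zero, ← this]
  module

lemma act_comm (h h' : G) (r : D.R) : D.act h (D.act h' r) = D.act h' (D.act h r) := by
  rw [← AlgHom.mul_apply, ← AlgHom.mul_apply, ← map_mul, ← map_mul, mul_comm]

lemma serre_primMul {i j : Fin 2} (h : i ≠ j) : D.serreExpr D.primMul i j = 0 := by
  have h1 := D.qm_mul h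
  have h2 := D.qm_mul h.symm
  ext a b
  simp only [serreExpr, TensorProduct.AlgebraTensorModule.curry_apply, LinearMap.restrictScalars_self,
    TensorProduct.curry_apply, LinearMap.add_apply, LinearMap.sub_apply, LinearMap.smul_apply,
    Module.End.mul_apply, primMul_tmul, map_add, map_mul, act_x_qm, qm_self, LinearMap.zero_apply,
    smul_mul_assoc, mul_smul_comm, ← TensorProduct.smul_tmul', TensorProduct.tmul_smul,
    map_smul, D.serre_mul h, D.act_comm (D.g j) (D.g i), TensorProduct.sub_tmul, TensorProduct.tmul_sub]

  match_scalars <;> grind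

/-- The braided comultiplication of `R(V)`: the algebra map from `R` to the braided tensor product
algebra `R ⊗ R` for which the `xᵢ` are primitive. It is the orbit map of `1 ⊗ 1` under the
representation of `R` on `R ⊗ R` in which `xᵢ` acts as left multiplication by
`xᵢ ⊗ 1 + 1 ⊗ xᵢ`. -/
def comulRep : D.R →ₐ[k] Module.End k (D.R ⊗[k] D.R) :=
  D.liftR D.primMul fun _ _ h => D.serre_primMul h

@[simp] lemma comulRep_x (i : Fin 2) : D.comulRep (D.x i) = D.primMul i := by
  simp [comulRep]

/-- Elements that are homogeneous with respect to the coaction span `R(V)`. -/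
lemma hom_induction {p : D.R → Prop} (add : ∀ a b, p a → p b → p (a + b))
    (hom : ∀ (h : G) (r : D.R), D.coact r = MonoidAlgebra.single h (1 : k) ⊗ₜ[k] r → p r)
    (r : D.R) : p r := by
  have smul_hom : ∀ (c : k) (h : G) (r : D.R),
      D.coact r = MonoidAlgebra.single h (1 : k) ⊗ₜ[k] r →
      D.coact (c • r) = MonoidAlgebra.single h (1 : k) ⊗ₜ[k] (c • r) := by
    intro c h r hr
    rw [map_smul, hr, TensorProduct.tmul_smul]
  have key : ∀ r : D.R, r ∈ AddSubmonoid.closure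
      {r : D.R | ∃ h : G, D.coact r = MonoidAlgebra.single h (1 : k) ⊗ₜ[k] r} := by
    intro r
    induction r using D.R_induction with
    | add a b ha hb => exact add_mem ha hb
    | smul c a ha =>
      induction ha using AddSubmonoid.closure_induction with
      | mem r hr =>
        obtain ⟨h, hr⟩ := hr
        exact AddSubmonoid.subset_closure ⟨h, smul_hom c h r hr⟩
      | zero => rw [smul_zero]; exact zero_mem _
      | add a b _ _ ha hb => rw [smul_add]; exact add_mem ha hb
    | one => exact AddSubmonoid.subset_closure ⟨1, by rw [map_one]; rfl⟩
    | mul i a ha =>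
      induction ha using AddSubmonoid.closure_induction with
      | mem r hr =>
        obtain ⟨h, hr⟩ := hr
        refine AddSubmonoid.subset_closure ⟨D.g i * h, ?_⟩
        simp [hr]
      | zero => rw [mul_zero]; exact zero_mem _
      | add a b _ _ ha hb => rw [mul_add]; exact add_mem ha hb
  induction key r using AddSubmonoid.closure_induction with
  | mem r hr =>
    obtain ⟨h, hr⟩ := hr
    exact hom h r hr
  | zero => exact hom 1 0 (by simp)
  | add a b _ _ ha hb => exact add a b ha hb

/-- The counit of `R(V)`. -/
def counitHom : D.R →ₐ[k] k := D.liftR (fun _ => 0) fun _ _ _ => by simp [serreExpr]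

@[simp] lemma counitHom_x (i : Fin 2) : D.counitHom (D.x i) = 0 := by simp [counitHom]

/-- The comultiplication of `R(V)`. -/
def comulR : D.R →ₗ[k] D.R ⊗[k] D.R :=
  LinearMap.applyₗ ((1 : D.R) ⊗ₜ[k] (1 : D.R)) ∘ₗ D.comulRep.toLinearMap

lemma comulR_one : D.comulR 1 = 1 ⊗ₜ 1 := by simp [comulR]

lemma comulR_x_mul (i : Fin 2) (r : D.R) : D.comulR (D.x i * r) = D.primMul i (D.comulR r) := by
  simp [comulR]

lemma coact_act (h : G) (r : D.R) :
    D.coact (D.act h r) = (D.act h).toLinearMap.lTensor (MonoidAlgebra k G) (D.coact r) := by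
  have : D.coact.comp (D.act h)
      = (Algebra.TensorProduct.map (AlgHom.id k (MonoidAlgebra k G)) (D.act h)).comp D.coact :=
    D.algHom_ext_R fun i => by simp
  exact congrArg (fun f => f r) this

lemma comulR_act (h : G) (r : D.R) : D.comulR (D.act h r)
    = TensorProduct.map (D.act h).toLinearMap (D.act h).toLinearMap (D.comulR r) := by
  induction r using D.R_induction with
  | add a b ha hb => simp only [map_add, ha, hb]
  | smul c a ha => simp only [map_smul, ha]
  | one => simp [comulR_one]
  | mul i r hr =>
    rw [map_mul, act_x, smul_mul_assoc, map_smul, comulR_x_mul, comulR_x_mul, hr]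
    induction D.comulR r with
    | zero => simp
    | tmul a b =>
      simp [smul_add, TensorProduct.smul_tmul', D.act_comm h (D.g i)]
    | add u v hu hv => simp only [map_add, smul_add, hu, hv]

lemma counitHom_act (h : G) (r : D.R) : D.counitHom (D.act h r) = D.counitHom r := by
  have : D.counitHom.comp (D.act h) = D.counitHom := D.algHom_ext_R fun i => by simp
  exact congrArg (fun f => f r) this

/-- The coalgebra structure of `R(V)`. -/
instance : Coalgebra k D.R where
  comul := D.comulR
  counit := D.counitHom.toLinearMap
  coassoc := by
    ext r
    simp only [LinearMap.comp_apply, LinearEquiv.coe_coe]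
    induction r using D.R_induction with
    | add a b ha hb => simp only [map_add, ha, hb]
    | smul c a ha => simp only [map_smul, ha]
    | one => simp [comulR_one]
    | mul i r hr =>
      have h1 : ∀ w : D.R ⊗[k] D.R,
          TensorProduct.assoc k D.R D.R D.R (D.comulR.rTensor D.R (D.primMul i w))
          = (show D.R ⊗[k] (D.R ⊗[k] D.R) →ₗ[k] D.R ⊗[k] (D.R ⊗[k] D.R) from
              TensorProduct.map (LinearMap.mulLeft k (D.x i)) LinearMap.id
              + TensorProduct.map (D.act (D.g i)).toLinearMap (D.primMul i))
            (TensorProduct.assoc k D.R D.R D.R (D.comulR.rTensor D.R w)) := by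
        intro w
        induction w with
        | zero => simp
        | tmul a b =>
          simp only [primMul_tmul, map_add, LinearMap.rTensor_tmul, comulR_x_mul, comulR_act]
          induction D.comulR a with
          | zero => simp
          | tmul c d => simp [TensorProduct.add_tmul, TensorProduct.tmul_add, add_assoc]
          | add u v hu hv =>
            simp only [map_add, TensorProduct.add_tmul] at hu hv ⊢
            rw [← hu, ← hv]
            abel
        | add u v hu hv => simp only [map_add, hu, hv]
      have h2 : ∀ w : D.R ⊗[k] D.R, D.comulR.lTensor D.R (D.primMul i w)
          = (show D.R ⊗[k] (D.R ⊗[k] D.R) →ₗ[k] D.R ⊗[k] (D.R ⊗[k] D.R) from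
              TensorProduct.map (LinearMap.mulLeft k (D.x i)) LinearMap.id
              + TensorProduct.map (D.act (D.g i)).toLinearMap (D.primMul i))
            (D.comulR.lTensor D.R w) := by
        intro w
        induction w with
        | zero => simp
        | tmul a b => simp [comulR_x_mul]
        | add u v hu hv => simp only [map_add, hu, hv]
      rw [comulR_x_mul, h1, h2, hr]
  rTensor_counit_comp_comul := by
    ext r
    simp only [LinearMap.comp_apply]
    induction r using D.R_induction with
    | add a b ha hb => simp only [map_add, ha, hb]
    | smul c a ha => simp only [map_smul, ha]
    | one => simp [comulR_one]
    | mul i r hr =>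
      have h1 : ∀ w : D.R ⊗[k] D.R, D.counitHom.toLinearMap.rTensor D.R (D.primMul i w)
          = (LinearMap.mulLeft k (D.x i)).lTensor k
            (D.counitHom.toLinearMap.rTensor D.R w) := by
        intro w
        induction w with
        | zero => simp
        | tmul a b => simp [counitHom_act]
        | add u v hu hv => simp only [map_add, hu, hv]
      rw [comulR_x_mul, h1, hr]
      simp
  lTensor_counit_comp_comul := by
    ext r
    simp only [LinearMap.comp_apply]
    induction r using D.R_induction with
    | add a b ha hb => simp only [map_add, ha, hb]
    | smul c a ha => simp only [map_smul, ha]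
    | one => simp [comulR_one]
    | mul i r hr =>
      have h1 : ∀ w : D.R ⊗[k] D.R, D.counitHom.toLinearMap.lTensor D.R (D.primMul i w)
          = (LinearMap.mulLeft k (D.x i)).rTensor k
            (D.counitHom.toLinearMap.lTensor D.R w) := by
        intro w
        induction w with
        | zero => simp
        | tmul a b => simp
        | add u v hu hv => simp only [map_add, hu, hv]
      rw [comulR_x_mul, h1, hr]
      simp

/-- The operator `r ↦ -(gᵢ r) xᵢ` on `R(V)`. -/
def antiMul (i : Fin 2) : Module.End k D.R :=
  -(LinearMap.mulRight k (D.x i) ∘ₗ (D.act (D.g i)).toLinearMap)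

@[simp] lemma antiMul_apply (i : Fin 2) (r : D.R) :
    D.antiMul i r = -(D.act (D.g i) r * D.x i) := by simp [antiMul]

lemma serre_antiMul {i j : Fin 2} (h : i ≠ j) : D.serreExpr D.antiMul i j = 0 := by
  have h1 := D.qm_mul h
  have h2 := D.qm_mul h.symm
  ext a
  have h3 := D.serre_x h
  have h4 := congrArg (fun z => D.act (D.g i) (D.act (D.g i) (D.act (D.g j) a)) * z)
    (D.serre_x h)
  simp only [serreExpr, mul_add, mul_sub, mul_smul_comm, mul_zero] at h4
  have h5 : D.act (D.g i) (D.act (D.g i) (D.act (D.g j) a)) * (D.x i * (D.x i * D.x j))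
    = ((1 + D.q) * D.qm i j) •
        (D.act (D.g i) (D.act (D.g i) (D.act (D.g j) a)) * (D.x i * (D.x j * D.x i)))
      - (D.q * D.qm i j ^ 2) •
        (D.act (D.g i) (D.act (D.g i) (D.act (D.g j) a)) * (D.x j * (D.x i * D.x i))) := by
    rw [← sub_eq_zero, ← h4]
    module
  simp only [serreExpr, LinearMap.add_apply, LinearMap.sub_apply, LinearMap.smul_apply,
    Module.End.mul_apply, antiMul_apply, map_neg, map_mul, act_x_qm, qm_self, LinearMap.zero_apply,
    smul_mul_assoc, mul_smul_comm, neg_neg, map_smul, D.act_comm (D.g j) (D.g i),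
    mul_assoc, h5]
  match_scalars <;> grind

/-- The antipode `S` of `R(V)`, determined by `S(1) = 1` and `S(xᵢ r) = -S(gᵢ r) xᵢ`. -/
def antipodeR : D.R →ₗ[k] D.R :=
  LinearMap.applyₗ (1 : D.R) ∘ₗ (D.liftR D.antiMul fun _ _ h => D.serre_antiMul h).toLinearMap

lemma antipodeR_one : D.antipodeR 1 = 1 := by simp [antipodeR]

lemma antipodeR_x_mul (i : Fin 2) (r : D.R) :
    D.antipodeR (D.x i * r) = -(D.act (D.g i) (D.antipodeR r) * D.x i) := by
  simp [antipodeR]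

lemma antipodeR_act (h : G) (r : D.R) :
    D.antipodeR (D.act h r) = D.act h (D.antipodeR r) := by
  induction r using D.R_induction with
  | add a b ha hb => simp only [map_add, ha, hb]
  | smul c a ha => simp only [map_smul, ha]
  | one => simp [antipodeR_one]
  | mul i r hr =>
    simp [antipodeR_x_mul, hr, D.act_comm h (D.g i)]

/-- `R(V)` as an algebra in the category of crossed `kG`-modules. -/
def crossed : CrossedAlgebra k G D.R where
  act := D.act
  coact := D.coact
  coact_coassoc r := by
    induction r using D.hom_induction with
    | add a b ha hb => simp only [map_add, ha, hb]
    | hom h r hr => simp [hr]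
  coact_counit r := by
    induction r using D.hom_induction with
    | add a b ha hb => simp only [map_add, ha, hb, TensorProduct.tmul_add]
    | hom h r hr => simp [hr]
  coact_act := D.coact_act

lemma braidedMul_primMul (i : Fin 2) (w w' : D.R ⊗[k] D.R) :
    D.crossed.braidedMul (D.primMul i w ⊗ₜ w') = D.primMul i (D.crossed.braidedMul (w ⊗ₜ w')) := by
  induction w' with
  | zero => simp
  | add u v hu hv => simp only [TensorProduct.tmul_add, map_add, hu, hv]
  | tmul c d =>
    induction w with
    | zero => simp
    | add u v hu hv => simp only [TensorProduct.add_tmul, map_add, hu, hv]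
    | tmul a b =>
      induction b using D.hom_induction with
      | add b b' hb hb' =>
        simp only [TensorProduct.tmul_add, TensorProduct.add_tmul, map_add, hb, hb']
      | hom h b hb =>
        have hxb : D.crossed.coact (D.x i * b)
            = MonoidAlgebra.single (D.g i * h) (1 : k) ⊗ₜ[k] (D.x i * b) := by
          change D.coact _ = _
          simp [hb]
        rw [primMul_tmul, TensorProduct.add_tmul, map_add, D.crossed.braidedMul_tmul hb,
          D.crossed.braidedMul_tmul hxb, D.crossed.braidedMul_tmul hb, primMul_tmul]
        simp [crossed, mul_assoc]

lemma tensorCoact_primMul (i : Fin 2) (w : D.R ⊗[k] D.R) :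
    D.crossed.tensorCoact (D.primMul i w)
      = TensorProduct.map (LinearMap.mulLeft k (MonoidAlgebra.single (D.g i) (1 : k)))
        (D.primMul i) (D.crossed.tensorCoact w) := by
  induction w with
  | zero => simp
  | add u v hu hv => simp only [map_add, hu, hv]
  | tmul a b =>
    induction b using D.hom_induction with
    | add b b' hb hb' => simp only [TensorProduct.tmul_add, map_add, hb, hb']
    | hom h' b hb =>
      induction a using D.hom_induction with
      | add a a' ha ha' => simp only [TensorProduct.add_tmul, map_add, ha, ha']
      | hom h a ha =>
        have hxb : D.crossed.coact (D.x i * b)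
            = MonoidAlgebra.single (D.g i * h') (1 : k) ⊗ₜ[k] (D.x i * b) := by
          change D.coact _ = _
          simp [hb]
        have hxa : D.crossed.coact (D.x i * a)
            = MonoidAlgebra.single (D.g i * h) (1 : k) ⊗ₜ[k] (D.x i * a) := by
          change D.coact _ = _
          simp [ha]
        have hga : D.crossed.coact (D.act (D.g i) a)
            = MonoidAlgebra.single h (1 : k) ⊗ₜ[k] D.act (D.g i) a := by
          change D.coact _ = _
          simp [coact_act, ha]
        rw [primMul_tmul, map_add, D.crossed.tensorCoact_tmul hxa hb,
          D.crossed.tensorCoact_tmul hga hxb, D.crossed.tensorCoact_tmul ha hb]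
        have e : h * (D.g i * h') = D.g i * (h * h') := mul_left_comm _ _ _
        simp [e, mul_assoc, TensorProduct.tmul_add]

lemma comulR_mul (r s : D.R) :
    D.comulR (r * s) = D.crossed.braidedMul (D.comulR r ⊗ₜ D.comulR s) := by
  induction r using D.R_induction with
  | add a b ha hb => simp only [add_mul, map_add, TensorProduct.add_tmul, ha, hb]
  | smul c a ha => simp only [smul_mul_assoc, map_smul, ← TensorProduct.smul_tmul', ha]
  | one =>
    have h1 : D.crossed.coact (1 : D.R) = MonoidAlgebra.single (1 : G) (1 : k) ⊗ₜ[k] (1 : D.R) := by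
      rw [map_one]; rfl
    rw [one_mul, comulR_one]
    induction D.comulR s with
    | zero => simp
    | add u v hu hv => rw [TensorProduct.tmul_add, map_add, ← hu, ← hv]
    | tmul c d => rw [D.crossed.braidedMul_tmul h1]; simp
  | mul i r hr => rw [mul_assoc, comulR_x_mul, comulR_x_mul, braidedMul_primMul, hr]

/-- `R(V)` as a braided Hopf algebra in the category of crossed `kG`-modules. -/
def hopf : BraidedHopfAlgebra k G D.R where
  toCrossedAlgebra := D.crossed
  comul_act := D.comulR_act
  counit_act := D.counitHom_act
  comul_coact r := by
    change D.crossed.tensorCoact (D.comulR r) = D.comulR.lTensor (MonoidAlgebra k G) (D.coact r)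
    induction r using D.R_induction with
    | add a b ha hb => simp only [map_add, ha, hb]
    | smul c a ha => simp only [map_smul, ha]
    | one =>
      have h1 : D.crossed.coact (1 : D.R)
          = MonoidAlgebra.single (1 : G) (1 : k) ⊗ₜ[k] (1 : D.R) := by
        rw [map_one]; rfl
      rw [comulR_one, D.crossed.tensorCoact_tmul h1 h1, map_one, Algebra.TensorProduct.one_def,
        LinearMap.lTensor_tmul, comulR_one, mul_one]
      rfl
    | mul i r hr =>
      rw [comulR_x_mul, tensorCoact_primMul, hr, map_mul, coact_x]
      induction D.coact r with
      | zero => simp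
      | add u v hu hv => simp only [mul_add, map_add, hu, hv]
      | tmul s t => simp [comulR_x_mul]
  counit_coact r := by
    have : (Algebra.TensorProduct.map (AlgHom.id k (MonoidAlgebra k G)) D.counitHom).comp D.coact
        = (Algebra.TensorProduct.includeRight).comp D.counitHom :=
      D.algHom_ext_R fun i => by simp
    exact congrArg (fun f => f r) this
  comul_one := D.comulR_one
  comul_mul := D.comulR_mul
  counit_one := map_one D.counitHom
  counit_mul := map_mul D.counitHom
  antipode := D.antipodeR
  mul_antipode_rTensor_comul r := by
    change LinearMap.mul' k D.R (D.antipodeR.rTensor D.R (D.comulR r))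
      = algebraMap k D.R (D.counitHom r)
    induction r using D.R_induction with
    | add a b ha hb => simp only [map_add, ha, hb]
    | smul c a ha =>
      simp only [map_smul, ha, smul_eq_mul, Algebra.algebraMap_eq_smul_one, mul_smul]
    | one => simp [comulR_one, antipodeR_one]
    | mul i r hr =>
      rw [comulR_x_mul, map_mul, counitHom_x, zero_mul, map_zero]
      induction D.comulR r with
      | zero => simp
      | add u v hu hv => simp only [map_add, hu, hv, add_zero]
      | tmul a b => simp [antipodeR_x_mul, antipodeR_act, mul_assoc]
  mul_antipode_lTensor_comul r := by
    change LinearMap.mul' k D.R (D.antipodeR.lTensor D.R (D.comulR r))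
      = algebraMap k D.R (D.counitHom r)
    induction r using D.R_induction with
    | add a b ha hb => simp only [map_add, ha, hb]
    | smul c a ha =>
      simp only [map_smul, ha, smul_eq_mul, Algebra.algebraMap_eq_smul_one, mul_smul]
    | one => simp [comulR_one, antipodeR_one]
    | mul i r hr =>
      have h1 : ∀ w : D.R ⊗[k] D.R,
          LinearMap.mul' k D.R (D.antipodeR.lTensor D.R (D.primMul i w))
          = D.x i * LinearMap.mul' k D.R (D.antipodeR.lTensor D.R w)
            - D.act (D.g i) (LinearMap.mul' k D.R (D.antipodeR.lTensor D.R w)) * D.x i := by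
        intro w
        induction w with
        | zero => simp
        | add u v hu hv => simp only [map_add, hu, hv, mul_add, add_mul]; abel
        | tmul a b => simp [antipodeR_x_mul, mul_assoc, sub_eq_add_neg]
      rw [comulR_x_mul, h1, hr, map_mul, counitHom_x, zero_mul, map_zero, AlgHom.commutes,
        Algebra.commutes, sub_self]

/-- The simple root vector `e₁₂ = x₀`. -/
def e12 : D.R := D.x 0

/-- The simple root vector `e₂₃ = x₁`. -/
def e23 : D.R := D.x 1

/-- The root vector `e₁₃ = [e₁₂, e₂₃]`, the braided commutator
`e₁₂ e₂₃ - (g₀ e₂₃) e₁₂ = x₀ x₁ - χ₁(g₀) x₁ x₀`. -/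
def e13 : D.R := D.x 0 * D.x 1 - (D.χ 1 (D.g 0) : k) • (D.x 1 * D.x 0)

/-- The subalgebra `K(V)` of `R(V)` generated by the `N`-th powers
`z₁₂, z₁₃, z₂₃` of the root vectors. -/
def K : Subalgebra k D.R := Algebra.adjoin k {D.e12 ^ D.N, D.e13 ^ D.N, D.e23 ^ D.N}

/-- The element `z₁₃ = e₁₃ᴺ` of `K(V)`. -/
def z13 : D.K := ⟨D.e13 ^ D.N, Algebra.subset_adjoin (by simp)⟩

/-- The explicit formula for the retraction: for the PBW monomial `e = e₁₂ᵐ e₁₃ⁿ e₂₃ˡ` with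
`0 ≤ m, n, l < N` and for `z ∈ K`, the value at `e z` is the value `ε(e) z` of the naive retraction
plus, when `m = l` and `m + n = N`, the term
`(1 - q⁻¹)^(n-N) χ₀(g₁)^(n(n-1)/2 - N(N-1)/2) z₁₃ z`. -/
def IsDeformedRetraction (u : D.R →ₗ[k] D.K) : Prop :=
  ∀ m n l : ℕ, m < D.N → n < D.N → l < D.N → ∀ z : D.K,
    u (D.e12 ^ m * D.e13 ^ n * D.e23 ^ l * z)
      = Coalgebra.counit (R := k) (D.e12 ^ m * D.e13 ^ n * D.e23 ^ l) • z
        + if m = l ∧ m + n = D.N then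
            ((1 - D.q⁻¹) ^ ((n : ℤ) - (D.N : ℤ))
              * (D.χ 0 (D.g 1) : k) ^ ((n.choose 2 : ℤ) - (D.N.choose 2 : ℤ))) • (D.z13 * z)
          else 0

end DiagramA2
end

/-! Write p = `D.qm 1 0` and ρ = p ^ N. In terms of `e13`, the Serre relations say only that `e13`
p-commutes with `e12` and `e23`. Hence the ordered monomials span `R`, and a representation on the
vector space with these monomials as basis shows that they are independent. Since q has order N, the
N-th powers of the root vectors commute with every ordered monomial up to powers of ρ. So `K` is
spanned by the monomials whose exponents are multiples of N, and `R` is free over `K` on the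
restricted monomials (exponents below N). This gives existence and uniqueness of the map.

The correction term lives on restricted monomials with m = l and m + n = N. These have the same
bidegree (N, N) in the two generators as z₁₃, and an element of `K` moves past them with the same
scalar as past z₁₃. This gives bimodule linearity (`apply_mul_of_skew`) and compatibility with
action and coaction.

For the comultiplication, left linearity and `map_comulRep` reduce the claim to restricted
monomials. Their bidegree is below (2N, 2N), while the map kills every monomial whose bidegree is
not a multiple of N. Apart from the terms with a factor 1, only multiples of x₀ᴺ ⊗ x₁ᴺ and x₁ᴺ ⊗ x₀ᴺ
can therefore survive in the image of Δ(e) (`apply_tmul`). The second does not occur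
(`powCoeff₂_comulR_mono_swap`). The first has coefficient (1 - q⁻¹)ⁿ p^(n choose 2) in Δ(e), and the
same expression with N for n in Δ(z₁₃) (`comulRep_z13`). The quotient of the two is exactly the
coefficient in the definition of the deformed retraction (`defCoeff_mul`). The naive retraction
fails because it has no term to account for x₀ᴺ ⊗ x₁ᴺ. -/

open scoped TensorProduct

noncomputable section

/-! ### The q-binomial theorem at a root of unity. -/

section QBinomial

variable {k A : Type*} [Field k] [Ring A] [Algebra k A]

/-- The Gaussian binomial coefficients, evaluated at `q`. -/
def gaussChoose (q : k) : ℕ → ℕ → k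
  | _, 0 => 1
  | 0, _ + 1 => 0
  | n + 1, i + 1 => gaussChoose q n i + q ^ (i + 1) * gaussChoose q n (i + 1)

@[simp] lemma gaussChoose_zero_right (q : k) (n : ℕ) : gaussChoose q n 0 = 1 := by
  cases n <;> rfl

lemma gaussChoose_succ_succ (q : k) (n i : ℕ) : gaussChoose q (n + 1) (i + 1)
    = gaussChoose q n i + q ^ (i + 1) * gaussChoose q n (i + 1) := rfl

lemma gaussChoose_of_lt (q : k) {n i : ℕ} (h : n < i) : gaussChoose q n i = 0 := by
  induction n generalizing i with
  | zero => obtain ⟨j, rfl⟩ := Nat.exists_eq_add_of_lt h; rfl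
  | succ n ih =>
    obtain ⟨j, rfl⟩ : ∃ j, i = j + 1 := ⟨i - 1, by omega⟩
    rw [gaussChoose_succ_succ, ih (by omega), ih (by omega)]
    simp

lemma gaussChoose_self (q : k) (n : ℕ) : gaussChoose q n n = 1 := by
  induction n with
  | zero => rfl
  | succ n ih => rw [gaussChoose_succ_succ, ih, gaussChoose_of_lt q n.lt_succ_self]; simp

/-- A division-free substitute for the quotient of q-factorials, which is meaningless at a root of
unity. For n + 1 = N the right side vanishes, which kills the inner Gaussian coefficients. -/
lemma one_sub_pow_mul_gaussChoose (q : k) (n i : ℕ) :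
    (1 - q ^ (i + 1)) * gaussChoose q (n + 1) (i + 1) = (1 - q ^ (n + 1)) * gaussChoose q n i := by
  induction n generalizing i with
  | zero =>
    cases i with
    | zero => simp [gaussChoose_self]
    | succ i => simp [gaussChoose_of_lt]
  | succ n ih =>
    cases i with
    | zero =>
      have := ih 0
      rw [gaussChoose_succ_succ]
      simp only [gaussChoose_zero_right, zero_add] at this ⊢
      linear_combination q ^ 1 * this
    | succ i =>
      have h1 := ih (i + 1)
      have h2 := ih i
      have h3 := gaussChoose_succ_succ q n i
      rw [gaussChoose_succ_succ q (n + 1) (i + 1)]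
      linear_combination q ^ (i + 2) * h1 + q * h2 - q * (1 - q ^ (n + 1)) * h3

lemma gaussChoose_eq_zero {q : k} {N : ℕ} (hq : IsPrimitiveRoot q N) {i : ℕ} (h0 : 0 < i)
    (h1 : i < N) : gaussChoose q N i = 0 := by
  obtain ⟨n, rfl⟩ : ∃ n, N = n + 1 := ⟨N - 1, by omega⟩
  obtain ⟨i, rfl⟩ : ∃ j, i = j + 1 := ⟨i - 1, by omega⟩
  have := one_sub_pow_mul_gaussChoose q n i
  rw [hq.pow_eq_one, sub_self, zero_mul] at this
  exact (mul_eq_zero.mp this).resolve_left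
    (sub_ne_zero.mpr (hq.pow_ne_one_of_pos_of_lt (by omega) h1).symm)

/-- Powers of skew-commuting elements skew-commute. -/
lemma pow_mul_pow_of_skew {s : k} {x y : A} (h : y * x = s • (x * y)) (i j : ℕ) :
    y ^ j * x ^ i = s ^ (i * j) • (x ^ i * y ^ j) := by
  have h1 : ∀ i, y * x ^ i = s ^ i • (x ^ i * y) := by
    intro i
    induction i with
    | zero => simp
    | succ i ih =>
      rw [pow_succ, ← mul_assoc, ih, smul_mul_assoc, mul_assoc, h, mul_smul_comm, smul_smul,
        ← mul_assoc, pow_succ]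
  induction j with
  | zero => simp
  | succ j ih =>
    rw [pow_succ' y, mul_assoc, ih, mul_smul_comm, ← mul_assoc, h1, smul_mul_assoc, smul_smul,
      mul_assoc, mul_add, pow_add, mul_one]

/-- The `q`-binomial theorem. -/
lemma add_pow_of_skew {q : k} {x y : A} (h : y * x = q • (x * y)) (n : ℕ) :
    (x + y) ^ n = ∑ i ∈ Finset.range (n + 1), gaussChoose q n i • (x ^ (n - i) * y ^ i) := by
  have h1 : ∀ i, y ^ i * x = q ^ i • (x * y ^ i) := fun i => by
    simpa using pow_mul_pow_of_skew h 1 i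
  induction n with
  | zero => simp
  | succ n ih =>
    have h2 : ∑ i ∈ Finset.range (n + 1), gaussChoose q n i • (x ^ (n - i) * y ^ i) * x
        = ∑ i ∈ Finset.range (n + 2), (q ^ i * gaussChoose q n i) • (x ^ (n + 1 - i) * y ^ i) := by
      rw [Finset.sum_range_succ _ (n + 1), gaussChoose_of_lt q n.lt_succ_self]
      simp only [mul_zero, zero_smul, add_zero]
      refine Finset.sum_congr rfl fun i hi => ?_
      rw [smul_mul_assoc, mul_assoc, h1, mul_smul_comm, smul_smul, ← mul_assoc, ← pow_succ,
        Nat.succ_sub (Nat.lt_succ_iff.mp (Finset.mem_range.mp hi)), mul_comm (q ^ i)]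
    rw [pow_succ, ih, mul_add, Finset.sum_mul, Finset.sum_mul, h2, Finset.sum_range_succ',
      Finset.sum_range_succ' _ (n + 1), add_right_comm, ← Finset.sum_add_distrib]
    congr 1
    · refine Finset.sum_congr rfl fun i _ => ?_
      rw [gaussChoose_succ_succ, add_smul, smul_mul_assoc, mul_assoc, ← pow_succ,
        Nat.succ_sub_succ, add_comm]
    · simp

/-- At a primitive `N`-th root of unity `q`, taking `N`-th powers is additive on
`q`-commuting elements. -/
lemma add_pow_of_skew_of_primitive {q : k} {N : ℕ} (hN : 2 ≤ N) (hq : IsPrimitiveRoot q N)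
    {x y : A} (h : y * x = q • (x * y)) : (x + y) ^ N = x ^ N + y ^ N := by
  rw [add_pow_of_skew h, Finset.sum_range_succ, Finset.sum_eq_single 0]
  · simp [gaussChoose_self]
  · intro i hi hi0
    rw [gaussChoose_eq_zero hq (by omega) (Finset.mem_range.mp hi), zero_smul]
  · intro h0
    exact absurd (Finset.mem_range.mpr (by omega)) h0

/-- The `n`-th power of a product of skew-commuting elements. -/
lemma mul_pow_of_skew {s : k} {x y : A} (h : y * x = s • (x * y)) (n : ℕ) :
    (x * y) ^ n = s ^ n.choose 2 • (x ^ n * y ^ n) := by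
  induction n with
  | zero => simp
  | succ n ih =>
    have h1 := pow_mul_pow_of_skew h n 1
    rw [pow_one, mul_one] at h1
    rw [pow_succ', ih, mul_smul_comm, mul_assoc, ← mul_assoc y, h1, smul_mul_assoc,
      mul_smul_comm, smul_smul, Nat.choose_succ_succ', Nat.choose_one_right, pow_succ' x,
      pow_succ' y]
    congr 1
    · rw [← pow_add, add_comm]
    · noncomm_ring

end QBinomial

/-! ### Commutation relations of the root vectors. -/

namespace DiagramA2

variable {k G : Type*} [Field k] [CommGroup G] (D : DiagramA2 k G)

lemma qm_ne_zero (i j : Fin 2) : D.qm i j ≠ 0 := Units.ne_zero _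

lemma q_mul_qm_mul_qm : D.q * D.qm 0 1 * D.qm 1 0 = 1 := D.qm_mul (by decide)

lemma q_pow : D.q ^ D.N = 1 := D.q_primitive.pow_eq_one

lemma N_pos : 0 < D.N := lt_of_lt_of_le two_pos D.two_le_N

/-- The scalars (qm 0 1)⁻¹ and qm 1 0 differ by a power of q, so their N-th powers agree. This is
why a single scalar ρ = qm 1 0 ^ N governs all commutations with the N-th powers. -/
lemma qm_inv_pow : (D.qm 0 1)⁻¹ ^ D.N = D.qm 1 0 ^ D.N := by
  have h := congrArg (· ^ D.N) D.q_mul_qm_mul_qm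
  simp only [mul_pow, D.q_pow, one_mul, one_pow] at h
  rw [inv_pow]
  exact inv_eq_of_mul_eq_one_right h

lemma e13_eq : D.e13 = D.e12 * D.e23 - D.qm 0 1 • (D.e23 * D.e12) := rfl

lemma e13_mul_e12 : D.e13 * D.e12 = D.qm 1 0 • (D.e12 * D.e13) := by
  have h := D.serre_x (i := 0) (j := 1) (by decide)
  have hq := D.q_mul_qm_mul_qm
  -- The factor makes the coefficient of x₀x₀x₁ agree; the other two then agree because q · qm 0 1 ·
  -- qm 1 0 = 1.
  have h' := congrArg (fun z => -D.qm 1 0 • z) h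
  rw [← sub_eq_zero]
  simp only [serreExpr, smul_zero] at h'
  rw [← h', e13_eq, e12, e23]
  simp only [sub_mul, mul_sub, smul_mul_assoc, mul_smul_comm, mul_assoc, smul_sub]
  match_scalars <;> grind

lemma e23_mul_e13 : D.e23 * D.e13 = D.qm 1 0 • (D.e13 * D.e23) := by
  have h := D.serre_x (i := 1) (j := 0) (by decide)
  have hq := D.q_mul_qm_mul_qm
  have h' := congrArg (fun z => -D.qm 0 1 • z) h
  rw [← sub_eq_zero]
  simp only [serreExpr, smul_zero] at h'
  rw [← h', e13_eq, e12, e23]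
  simp only [sub_mul, mul_sub, smul_mul_assoc, mul_smul_comm, mul_assoc, smul_sub]
  match_scalars <;> grind

lemma e23_mul_e12 : D.e23 * D.e12 = (D.qm 0 1)⁻¹ • (D.e12 * D.e23 - D.e13) := by
  rw [e13_eq, sub_sub_cancel, inv_smul_smul₀ (D.qm_ne_zero 0 1)]

/-- The coefficients of the commutation relation between `e₂₃` and powers of `e₁₂`. -/
def comCoeff (m : ℕ) : k := (D.qm 0 1)⁻¹ ^ m * ∑ j ∈ Finset.range m, D.q⁻¹ ^ j

@[simp] lemma comCoeff_zero : D.comCoeff 0 = 0 := by simp [comCoeff]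

lemma inv_q_eq : D.q⁻¹ = D.qm 0 1 * D.qm 1 0 :=
  inv_eq_of_mul_eq_one_right (by rw [← mul_assoc, D.q_mul_qm_mul_qm])

lemma comCoeff_succ (m : ℕ) :
    D.comCoeff (m + 1) = (D.qm 0 1)⁻¹ * (D.comCoeff m + D.qm 1 0 ^ m) := by
  have h1 : (D.qm 0 1)⁻¹ ^ m * D.q⁻¹ ^ m = D.qm 1 0 ^ m := by
    rw [← mul_pow, inv_q_eq, inv_mul_cancel_left₀ (D.qm_ne_zero 0 1)]
  rw [comCoeff, Finset.sum_range_succ, comCoeff, ← h1]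
  ring

/-- Splits off the first term of the geometric sum instead of the last one. This form fits the
induction on powers of `e23`, the other one that on powers of `e12`. -/
lemma comCoeff_succ' (m : ℕ) :
    D.comCoeff (m + 1) = (D.qm 0 1)⁻¹ ^ (m + 1) + D.qm 1 0 * D.comCoeff m := by
  have h1 : D.qm 1 0 = (D.qm 0 1)⁻¹ * D.q⁻¹ := by
    rw [inv_q_eq, inv_mul_cancel_left₀ (D.qm_ne_zero 0 1)]
  rw [comCoeff, Finset.sum_range_succ', comCoeff, h1, Finset.mul_sum, Finset.mul_sum, mul_add,
    Finset.mul_sum]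
  rw [add_comm]
  congr 1
  · simp
  · exact Finset.sum_congr rfl fun i _ => by ring

/-- The geometric sum of a nontrivial N-th root of unity vanishes. Hence the `e13` term disappears
when an N-th power is moved past a simple root vector. -/
lemma comCoeff_N : D.comCoeff D.N = 0 := by
  rw [comCoeff, D.q_primitive.inv.geom_sum_eq_zero D.two_le_N, mul_zero]

lemma e23_mul_e12_pow (m : ℕ) : D.e23 * D.e12 ^ m
    = (D.qm 0 1)⁻¹ ^ m • (D.e12 ^ m * D.e23) - D.comCoeff m • (D.e12 ^ (m - 1) * D.e13) := by
  induction m with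
  | zero => simp
  | succ m ih =>
    -- For m = 0 the truncated exponent m - 1 is wrong, but harmless because `comCoeff 0 = 0`.
    have h1 : D.comCoeff m • (D.e12 * (D.e12 ^ (m - 1) * D.e13))
        = D.comCoeff m • (D.e12 ^ m * D.e13) := by
      cases m with
      | zero => simp
      | succ m => rw [← mul_assoc, ← pow_succ']; rfl
    have h2 := pow_mul_pow_of_skew D.e13_mul_e12 m 1
    simp only [pow_one, mul_one] at h2
    rw [pow_succ' D.e12, ← mul_assoc, e23_mul_e12, smul_mul_assoc, sub_mul, mul_assoc, ih, mul_sub,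
      mul_smul_comm, mul_smul_comm, h1, h2, comCoeff_succ, Nat.add_sub_cancel, ← mul_assoc]
    module

lemma e23_pow_mul_e12 (m : ℕ) : D.e23 ^ m * D.e12
    = (D.qm 0 1)⁻¹ ^ m • (D.e12 * D.e23 ^ m) - D.comCoeff m • (D.e13 * D.e23 ^ (m - 1)) := by
  induction m with
  | zero => simp
  | succ m ih =>
    have h1 : D.comCoeff m • (D.e13 * (D.e23 * D.e23 ^ (m - 1)))
        = D.comCoeff m • (D.e13 * D.e23 ^ m) := by
      cases m with
      | zero => simp
      | succ m => rw [← pow_succ']; rfl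
    have h2 : D.comCoeff m • (D.e23 * (D.e13 * D.e23 ^ (m - 1)))
        = D.qm 1 0 • D.comCoeff m • (D.e13 * D.e23 ^ m) := by
      rw [← h1, ← mul_assoc, e23_mul_e13, smul_mul_assoc, smul_comm, mul_assoc]
    rw [pow_succ' D.e23, mul_assoc, ih, mul_sub, mul_smul_comm, mul_smul_comm, h2, comCoeff_succ',
      Nat.add_sub_cancel, ← mul_assoc, e23_mul_e12, smul_mul_assoc, sub_mul, mul_assoc]
    module

lemma e23_mul_z12 : D.e23 * D.e12 ^ D.N = D.qm 1 0 ^ D.N • (D.e12 ^ D.N * D.e23) := by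
  rw [e23_mul_e12_pow, comCoeff_N, zero_smul, sub_zero, qm_inv_pow]

lemma z23_mul_e12 : D.e23 ^ D.N * D.e12 = D.qm 1 0 ^ D.N • (D.e12 * D.e23 ^ D.N) := by
  rw [e23_pow_mul_e12, comCoeff_N, zero_smul, sub_zero, qm_inv_pow]

/-! ### The PBW basis. -/

/-- The PBW monomials `e₁₂ᵐ e₁₃ⁿ e₂₃ˡ`. -/
def mono (m n l : ℕ) : D.R := D.e12 ^ m * D.e13 ^ n * D.e23 ^ l

@[simp] lemma mono_zero : D.mono 0 0 0 = 1 := by simp [mono]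

lemma e12_mul_mono (m n l : ℕ) : D.e12 * D.mono m n l = D.mono (m + 1) n l := by
  simp only [mono, pow_succ' D.e12, mul_assoc]

lemma e23_mul_mono (m n l : ℕ) : D.e23 * D.mono m n l
    = ((D.qm 0 1)⁻¹ ^ m * D.qm 1 0 ^ n) • D.mono m n (l + 1)
      - D.comCoeff m • D.mono (m - 1) (n + 1) l := by
  have h := pow_mul_pow_of_skew D.e23_mul_e13 n 1
  simp only [pow_one, mul_one] at h
  simp only [mono, ← mul_assoc, D.e23_mul_e12_pow, sub_mul, smul_mul_assoc]
  rw [mul_assoc (D.e12 ^ m) D.e23, h]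
  simp only [mul_assoc, pow_succ' D.e13, pow_succ' D.e23, mul_smul_comm, smul_smul,
    smul_mul_assoc]

lemma span_mono : Submodule.span k (Set.range fun t : ℕ × ℕ × ℕ => D.mono t.1 t.2.1 t.2.2) = ⊤ := by
  rw [eq_top_iff]
  rintro r -
  have hm : ∀ m n l, D.mono m n l
      ∈ Submodule.span k (Set.range fun t : ℕ × ℕ × ℕ => D.mono t.1 t.2.1 t.2.2) :=
    fun m n l => Submodule.subset_span ⟨(m, n, l), rfl⟩
  induction r using D.R_induction with
  | add a b ha hb => exact add_mem ha hb
  | smul c a ha => exact Submodule.smul_mem _ c ha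
  | one => simpa using hm 0 0 0
  | mul i r hr =>
    induction hr using Submodule.span_induction with
    | mem r hr =>
      obtain ⟨⟨m, n, l⟩, rfl⟩ := hr
      fin_cases i
      · exact (D.e12_mul_mono m n l).symm ▸ hm _ _ _
      · exact (D.e23_mul_mono m n l).symm ▸
          sub_mem (Submodule.smul_mem _ _ (hm _ _ _)) (Submodule.smul_mem _ _ (hm _ _ _))
    | zero => rw [mul_zero]; exact zero_mem _
    | add a b _ _ ha hb => rw [mul_add]; exact add_mem ha hb
    | smul c a _ ha => rw [mul_smul_comm]; exact Submodule.smul_mem _ c ha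

/-- The operators by which `x₀` and `x₁` act in the PBW representation of `R(V)`. -/
def pbwOp : Fin 2 → Module.End k (ℕ × ℕ × ℕ →₀ k) :=
  ![Finsupp.linearCombination k fun t => Finsupp.single (t.1 + 1, t.2.1, t.2.2) 1,
    Finsupp.linearCombination k fun t =>
      ((D.qm 0 1)⁻¹ ^ t.1 * D.qm 1 0 ^ t.2.1) • Finsupp.single (t.1, t.2.1, t.2.2 + 1) 1
        - D.comCoeff t.1 • Finsupp.single (t.1 - 1, t.2.1 + 1, t.2.2) 1]

lemma pbwOp_zero_single (m n l : ℕ) : D.pbwOp 0 (Finsupp.single (m, n, l) 1)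
    = Finsupp.single (m + 1, n, l) 1 := by simp [pbwOp]

lemma pbwOp_one_single (m n l : ℕ) : D.pbwOp 1 (Finsupp.single (m, n, l) 1)
    = ((D.qm 0 1)⁻¹ ^ m * D.qm 1 0 ^ n) • Finsupp.single (m, n, l + 1) 1
        - D.comCoeff m • Finsupp.single (m - 1, n + 1, l) 1 := by
  simp [pbwOp]

/-- The operator by which `e₁₃` acts in the PBW representation of `R(V)`. -/
def pbwOpCom : Module.End k (ℕ × ℕ × ℕ →₀ k) :=
  Finsupp.linearCombination k fun t => D.qm 1 0 ^ t.1 • Finsupp.single (t.1, t.2.1 + 1, t.2.2) 1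

lemma pbwOpCom_single (m n l : ℕ) : D.pbwOpCom (Finsupp.single (m, n, l) 1)
    = D.qm 1 0 ^ m • Finsupp.single (m, n + 1, l) 1 := by simp [pbwOpCom]

lemma pbwOpCom_eq : D.pbwOpCom = D.pbwOp 0 * D.pbwOp 1 - D.qm 0 1 • (D.pbwOp 1 * D.pbwOp 0) := by
  ext1 ⟨m, n, l⟩
  ext1
  have hp := D.qm_ne_zero 0 1
  simp only [LinearMap.comp_apply, Finsupp.lsingle_apply, LinearMap.sub_apply,
    Module.End.mul_apply, LinearMap.smul_apply, pbwOp_zero_single, pbwOp_one_single,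
    pbwOpCom_single, map_sub, map_smul, Nat.add_sub_cancel]
  have h1 : D.comCoeff m • (Finsupp.single (m - 1 + 1, n + 1, l) 1 : ℕ × ℕ × ℕ →₀ k)
      = D.comCoeff m • Finsupp.single (m, n + 1, l) 1 := by
    cases m <;> simp
  rw [h1, comCoeff_succ]
  match_scalars
  · field_simp
    ring
  · linear_combination (D.qm 1 0 ^ n * (D.qm 0 1)⁻¹ ^ m) * mul_inv_cancel₀ hp

lemma pbwOp_zero_mul_com :
    D.pbwOpCom * D.pbwOp 0 = D.qm 1 0 • (D.pbwOp 0 * D.pbwOpCom) := by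
  ext1 ⟨m, n, l⟩
  ext1
  simp only [LinearMap.comp_apply, Finsupp.lsingle_apply,
    Module.End.mul_apply, LinearMap.smul_apply, pbwOp_zero_single,
    pbwOpCom_single, map_smul, smul_smul, pow_succ']

lemma pbwOp_one_mul_com :
    D.pbwOp 1 * D.pbwOpCom = D.qm 1 0 • (D.pbwOpCom * D.pbwOp 1) := by
  ext1 ⟨m, n, l⟩
  ext1
  simp only [LinearMap.comp_apply, Finsupp.lsingle_apply,
    Module.End.mul_apply, LinearMap.smul_apply, pbwOp_one_single,
    pbwOpCom_single, map_smul, map_sub]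
  cases m with
  | zero => simp only [comCoeff_zero]; module
  | succ m => simp only [Nat.add_sub_cancel]; module

/-- The converse of the computation for the root vectors: two quadratic relations with the braided
commutator c imply the cubic Serre relations. For the PBW operators this leaves only short checks on
basis vectors. -/
lemma serreExpr_eq_zero {A : Type*} [Ring A] [Algebra k A] {a : Fin 2 → A} {c : A}
    (hc : c = a 0 * a 1 - D.qm 0 1 • (a 1 * a 0)) (h0 : c * a 0 = D.qm 1 0 • (a 0 * c))
    (h1 : a 1 * c = D.qm 1 0 • (c * a 1)) {i j : Fin 2} (h : i ≠ j) : D.serreExpr a i j = 0 := by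
  have hq := D.q_mul_qm_mul_qm
  subst hc
  have hij : (i = 0 ∧ j = 1) ∨ (i = 1 ∧ j = 0) := by omega
  rcases hij with ⟨rfl, rfl⟩ | ⟨rfl, rfl⟩
  · have h' := congrArg (fun z => -(D.q * D.qm 0 1) • z) (sub_eq_zero.mpr h0)
    simp only [smul_zero] at h'
    rw [← h', serreExpr]
    simp only [sub_mul, mul_sub, smul_mul_assoc, mul_smul_comm, mul_assoc, smul_sub]
    match_scalars <;> grind
  · have h' := congrArg (fun z => -(D.q * D.qm 1 0) • z) (sub_eq_zero.mpr h1)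
    simp only [smul_zero] at h'
    rw [← h', serreExpr]
    simp only [sub_mul, mul_sub, smul_mul_assoc, mul_smul_comm, mul_assoc, smul_sub]
    match_scalars <;> grind

lemma serre_pbwOp {i j : Fin 2} (h : i ≠ j) : D.serreExpr D.pbwOp i j = 0 :=
  D.serreExpr_eq_zero D.pbwOpCom_eq D.pbwOp_zero_mul_com D.pbwOp_one_mul_com h

/-- The PBW representation of `R(V)`. -/
def pbwRep : D.R →ₐ[k] Module.End k (ℕ × ℕ × ℕ →₀ k) :=
  D.liftR D.pbwOp fun _ _ h => D.serre_pbwOp h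

lemma pbwRep_e12 : D.pbwRep D.e12 = D.pbwOp 0 := D.liftR_x _ _ 0

lemma pbwRep_e23 : D.pbwRep D.e23 = D.pbwOp 1 := D.liftR_x _ _ 1

lemma pbwRep_e13 : D.pbwRep D.e13 = D.pbwOpCom := by
  rw [e13_eq, map_sub, map_smul, map_mul, map_mul, pbwRep_e12, pbwRep_e23, pbwOpCom_eq]

/-- Applied to the vacuum vector, distinct monomials give distinct basis vectors, so they are
linearly independent. -/
lemma pbwRep_mono (m n l : ℕ) :
    D.pbwRep (D.mono m n l) (Finsupp.single (0, 0, 0) 1) = Finsupp.single (m, n, l) 1 := by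
  have hl : ∀ l, (D.pbwOp 1 ^ l) (Finsupp.single (0, 0, 0) 1) = Finsupp.single (0, 0, l) 1 := by
    intro l
    induction l with
    | zero => simp
    | succ l ih => rw [pow_succ', Module.End.mul_apply, ih, pbwOp_one_single]; simp
  have hn : ∀ n, (D.pbwOpCom ^ n) (Finsupp.single (0, 0, l) 1) = Finsupp.single (0, n, l) 1 := by
    intro l
    induction l with
    | zero => simp
    | succ l ih => rw [pow_succ', Module.End.mul_apply, ih, pbwOpCom_single]; simp
  have hm : ∀ m, (D.pbwOp 0 ^ m) (Finsupp.single (0, n, l) 1) = Finsupp.single (m, n, l) 1 := by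
    intro l
    induction l with
    | zero => simp
    | succ l ih => rw [pow_succ', Module.End.mul_apply, ih, pbwOp_zero_single]
  simp only [mono, map_mul, map_pow, pbwRep_e12, pbwRep_e13, pbwRep_e23, Module.End.mul_apply,
    hl, hn, hm]

/-- The PBW basis of `R(V)`. -/
def pbw : Module.Basis (ℕ × ℕ × ℕ) k D.R :=
  Module.Basis.mk (v := fun t => D.mono t.1 t.2.1 t.2.2)
    (LinearIndependent.of_comp
      (LinearMap.applyₗ (Finsupp.single (0, 0, 0) (1 : k)) ∘ₗ D.pbwRep.toLinearMap) (by
        have := (Finsupp.basisSingleOne (R := k) (ι := ℕ × ℕ × ℕ)).linearIndependent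
        convert this using 1
        ext1 ⟨m, n, l⟩
        simpa using D.pbwRep_mono m n l))
    D.span_mono.ge

@[simp] lemma pbw_apply (m n l : ℕ) : D.pbw (m, n, l) = D.mono m n l := by simp [pbw]

/-! ### The N-th powers of the root vectors and the subalgebra they generate. -/

lemma z12_mul_mono (m n l : ℕ) :
    D.e12 ^ D.N * D.mono m n l = D.mono (m + D.N) n l := by
  simp only [mono, ← mul_assoc, ← pow_add, add_comm]

lemma z13_mul_mono (m n l : ℕ) :
    D.e13 ^ D.N * D.mono m n l = (D.qm 1 0 ^ D.N) ^ m • D.mono m (n + D.N) l := by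
  have h := pow_mul_pow_of_skew D.e13_mul_e12 m D.N
  simp only [mono, ← mul_assoc, h, smul_mul_assoc]
  rw [mul_assoc (D.e12 ^ m), ← pow_add, add_comm D.N, mul_comm m, pow_mul]

lemma z23_mul_mono (m n l : ℕ) :
    D.e23 ^ D.N * D.mono m n l = (D.qm 1 0 ^ D.N) ^ (m + n) • D.mono m n (l + D.N) := by
  have h1 := pow_mul_pow_of_skew D.z23_mul_e12 m 1
  have h2 := pow_mul_pow_of_skew D.e23_mul_e13 n D.N
  simp only [pow_one, mul_one] at h1
  simp only [mono, ← mul_assoc, h1, smul_mul_assoc]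
  rw [mul_assoc (D.e12 ^ m), h2, mul_smul_comm, smul_mul_assoc, smul_smul, ← mul_assoc,
    mul_assoc (D.e12 ^ m * _), ← pow_add, add_comm D.N, mul_comm n, pow_mul, ← pow_add]

lemma mono_mul_z12 (m n l : ℕ) :
    D.mono m n l * D.e12 ^ D.N = (D.qm 1 0 ^ D.N) ^ (n + l) • D.mono (m + D.N) n l := by
  have h1 := pow_mul_pow_of_skew D.e23_mul_z12 1 l
  have h2 := pow_mul_pow_of_skew D.e13_mul_e12 D.N n
  simp only [pow_one, one_mul] at h1
  simp only [mono, mul_assoc, h1, mul_smul_comm]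
  rw [← mul_assoc (D.e13 ^ n), h2, smul_mul_assoc, mul_smul_comm, smul_smul, ← mul_assoc,
    ← mul_assoc, ← pow_add, pow_mul, ← pow_add, mul_assoc, add_comm l]

lemma mono_mul_z13 (m n l : ℕ) :
    D.mono m n l * D.e13 ^ D.N = (D.qm 1 0 ^ D.N) ^ l • D.mono m (n + D.N) l := by
  have h := pow_mul_pow_of_skew D.e23_mul_e13 D.N l
  simp only [mono, mul_assoc, h, mul_smul_comm]
  rw [← mul_assoc (D.e13 ^ n), ← pow_add, pow_mul]

lemma mono_mul_z23 (m n l : ℕ) :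
    D.mono m n l * D.e23 ^ D.N = D.mono m n (l + D.N) := by
  simp only [mono, mul_assoc, ← pow_add]

lemma z12_mem : D.e12 ^ D.N ∈ D.K := Algebra.subset_adjoin (by simp)

lemma z13_mem : D.e13 ^ D.N ∈ D.K := Algebra.subset_adjoin (by simp)

lemma z23_mem : D.e23 ^ D.N ∈ D.K := Algebra.subset_adjoin (by simp)

lemma K_mul_induction {p : D.R → Prop} (add : ∀ a b, p a → p b → p (a + b))
    (smul : ∀ (c : k) a, p a → p (c • a)) (z12 : ∀ r, p r → p (D.e12 ^ D.N * r))
    (z13 : ∀ r, p r → p (D.e13 ^ D.N * r)) (z23 : ∀ r, p r → p (D.e23 ^ D.N * r))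
    {z : D.R} (hz : z ∈ D.K) {r : D.R} (hr : p r) : p (z * r) := by
  induction hz using Algebra.adjoin_induction generalizing r with
  | mem x hx =>
    simp only [Set.mem_insert_iff, Set.mem_singleton_iff] at hx
    rcases hx with rfl | rfl | rfl
    · exact z12 r hr
    · exact z13 r hr
    · exact z23 r hr
  | algebraMap c => rw [← Algebra.smul_def]; exact smul c r hr
  | add x y _ _ hx hy => rw [add_mul]; exact add _ _ (hx hr) (hy hr)
  | mul x y _ _ hx hy => rw [mul_assoc]; exact hx (hy hr)

/-- The span contains 1 and is stable under left multiplication by the three generators, since each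
only shifts one exponent by N and multiplies by a power of ρ. -/
lemma mem_span_mono_of_mem_K {z : D.R} (hz : z ∈ D.K) : z ∈ Submodule.span k
    (Set.range fun t : ℕ × ℕ × ℕ => D.mono (t.1 * D.N) (t.2.1 * D.N) (t.2.2 * D.N)) := by
  set M := Submodule.span k
    (Set.range fun t : ℕ × ℕ × ℕ => D.mono (t.1 * D.N) (t.2.1 * D.N) (t.2.2 * D.N)) with hM
  have hm : ∀ i j l, D.mono (i * D.N) (j * D.N) (l * D.N) ∈ M :=
    fun i j l => Submodule.subset_span ⟨(i, j, l), rfl⟩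
  have hmul : ∀ z : D.R, (∀ i j l, z * D.mono (i * D.N) (j * D.N) (l * D.N) ∈ M) →
      ∀ r ∈ M, z * r ∈ M := by
    intro z h r hr
    induction hr using Submodule.span_induction with
    | mem r hr => obtain ⟨⟨i, j, l⟩, rfl⟩ := hr; exact h i j l
    | zero => rw [mul_zero]; exact zero_mem _
    | add a b _ _ ha hb => rw [mul_add]; exact add_mem ha hb
    | smul c a _ ha => rw [mul_smul_comm]; exact Submodule.smul_mem _ c ha
  rw [← mul_one z]
  refine D.K_mul_induction (p := (· ∈ M)) (fun _ _ => add_mem)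
    (fun c a h => Submodule.smul_mem _ c h) (hmul _ ?_) (hmul _ ?_) (hmul _ ?_) hz
    (by simpa using hm 0 0 0)
  · intro i j l
    rw [z12_mul_mono, ← Nat.succ_mul]
    exact hm _ _ _
  · intro i j l
    rw [z13_mul_mono, ← Nat.succ_mul]
    exact Submodule.smul_mem _ _ (hm _ _ _)
  · intro i j l
    rw [z23_mul_mono, ← Nat.succ_mul]
    exact Submodule.smul_mem _ _ (hm _ _ _)

/-! ### Action and coaction on the monomials. -/

lemma act_e12 (h : G) : D.act h D.e12 = (D.χ 0 h : k) • D.e12 := D.act_x h 0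

lemma act_e23 (h : G) : D.act h D.e23 = (D.χ 1 h : k) • D.e23 := D.act_x h 1

lemma act_e13 (h : G) : D.act h D.e13 = ((D.χ 0 h : k) * (D.χ 1 h : k)) • D.e13 := by
  simp only [e13_eq, map_sub, map_smul, map_mul, act_e12, act_e23, smul_mul_assoc, mul_smul_comm]
  module

lemma act_mono (h : G) (m n l : ℕ) : D.act h (D.mono m n l)
    = ((D.χ 0 h : k) ^ (m + n) * (D.χ 1 h : k) ^ (n + l)) • D.mono m n l := by
  simp only [mono, map_mul, map_pow, act_e12, act_e23, act_e13, smul_pow, smul_mul_assoc,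
    mul_smul_comm, smul_smul]
  congr 1
  ring

lemma coact_e12 : D.coact D.e12 = MonoidAlgebra.single (D.g 0) (1 : k) ⊗ₜ[k] D.e12 := D.coact_x 0

lemma coact_e23 : D.coact D.e23 = MonoidAlgebra.single (D.g 1) (1 : k) ⊗ₜ[k] D.e23 := D.coact_x 1

lemma coact_e13 : D.coact D.e13 = MonoidAlgebra.single (D.g 0 * D.g 1) (1 : k) ⊗ₜ[k] D.e13 := by
  simp only [e13_eq, map_sub, map_smul, map_mul, coact_e12, coact_e23,
    Algebra.TensorProduct.tmul_mul_tmul, MonoidAlgebra.single_mul_single, mul_one,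
    mul_comm (D.g 1), TensorProduct.tmul_sub, TensorProduct.tmul_smul]

lemma coact_mono (m n l : ℕ) : D.coact (D.mono m n l)
    = MonoidAlgebra.single (D.g 0 ^ (m + n) * D.g 1 ^ (n + l)) (1 : k) ⊗ₜ[k] D.mono m n l := by
  simp only [mono, map_mul, map_pow, coact_e12, coact_e23, coact_e13,
    Algebra.TensorProduct.tmul_mul_tmul, Algebra.TensorProduct.tmul_pow,
    MonoidAlgebra.single_pow, MonoidAlgebra.single_mul_single, mul_one, one_pow]
  congr 2
  simp only [mul_pow, pow_add, mul_assoc]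

/-! ### Comultiplication of the N-th powers. -/

lemma act_toLinearMap_pow (h : G) (n : ℕ) :
    (D.act h).toLinearMap ^ n = (D.act (h ^ n)).toLinearMap := by
  induction n with
  | zero => ext; simp
  | succ n ih => rw [pow_succ, ih, pow_succ, map_mul]; rfl

lemma comulR_mul_eq (r s : D.R) : D.comulR (r * s) = D.comulRep r (D.comulR s) := by
  simp [comulR]

lemma comulR_eq (r : D.R) : D.comulR r = D.comulRep r (1 ⊗ₜ 1) := rfl

/-- The two summands of `primMul` q-commute because gᵢ acts on xᵢ by q, so all mixed terms of the
N-th power vanish. -/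
lemma comulRep_x_pow (i : Fin 2) : D.comulRep (D.x i ^ D.N)
    = TensorProduct.map (LinearMap.mulLeft k (D.x i ^ D.N)) LinearMap.id
      + TensorProduct.map (D.act (D.g i ^ D.N)).toLinearMap
        (LinearMap.mulLeft k (D.x i ^ D.N)) := by
  rw [map_pow, comulRep_x, primMul, add_pow_of_skew_of_primitive D.two_le_N D.q_primitive,
    TensorProduct.map_pow, TensorProduct.map_pow, LinearMap.pow_mulLeft, act_toLinearMap_pow,
    ← Module.End.one_eq_id, one_pow]
  ext a b
  simp [D.χ_self i, TensorProduct.smul_tmul']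

/-- In the braided commutator the terms x₁ ⊗ x₀ cancel, while x₀ ⊗ x₁ keeps the coefficient 1 - qm 0
1 · qm 1 0 = 1 - q⁻¹. -/
lemma comulRep_e13 : D.comulRep D.e13
    = TensorProduct.map (LinearMap.mulLeft k D.e13) LinearMap.id
      + ((1 - D.q⁻¹) • TensorProduct.map (LinearMap.mulLeft k D.e12 * (D.act (D.g 1)).toLinearMap)
          (LinearMap.mulLeft k D.e23)
        + TensorProduct.map (D.act (D.g 0 * D.g 1)).toLinearMap (LinearMap.mulLeft k D.e13)) := by
  have hp := D.inv_q_eq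
  have h0 : D.comulRep D.e12 = D.primMul 0 := D.comulRep_x 0
  have h1 : D.comulRep D.e23 = D.primMul 1 := D.comulRep_x 1
  rw [e13_eq, map_sub, map_smul, map_mul, map_mul, h0, h1]
  ext a b
  simp only [e12, e23, TensorProduct.AlgebraTensorModule.curry_apply,
    LinearMap.restrictScalars_self,
    TensorProduct.curry_apply, LinearMap.add_apply, LinearMap.sub_apply, LinearMap.smul_apply,
    Module.End.mul_apply, primMul_tmul, map_add, map_mul, act_x_qm,
    TensorProduct.map_tmul, LinearMap.mulLeft_apply, LinearMap.id_apply, AlgHom.toLinearMap_apply,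
    smul_mul_assoc, TensorProduct.tmul_smul, AlgHom.mul_apply, D.act_comm (D.g 1) (D.g 0),
    TensorProduct.sub_tmul, TensorProduct.tmul_sub, sub_mul, mul_assoc,
    ← TensorProduct.smul_tmul']
  match_scalars <;> grind

/-- The first summand of the formula for `e13` q-commutes with the sum of the other two, and these
q-commute with each other, so taking N-th powers is additive twice. Separating e₁₂ from g₁ in the
N-th power of the mixed term yields the power of qm 1 0. -/
lemma comulRep_z13 : D.comulRep (D.e13 ^ D.N)
    = TensorProduct.map (LinearMap.mulLeft k (D.e13 ^ D.N)) LinearMap.id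
      + (((1 - D.q⁻¹) ^ D.N * D.qm 1 0 ^ D.N.choose 2) •
          TensorProduct.map (LinearMap.mulLeft k (D.e12 ^ D.N) * (D.act (D.g 1 ^ D.N)).toLinearMap)
            (LinearMap.mulLeft k (D.e23 ^ D.N))
        + TensorProduct.map (D.act ((D.g 0 * D.g 1) ^ D.N)).toLinearMap
          (LinearMap.mulLeft k (D.e13 ^ D.N))) := by
  have hq := D.q_mul_qm_mul_qm
  have hs : (D.act (D.g 1)).toLinearMap * LinearMap.mulLeft k D.e12
      = D.qm 1 0 • (LinearMap.mulLeft k D.e12 * (D.act (D.g 1)).toLinearMap) := by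
    ext a
    simp [act_e12, qm]
  have h11 : (D.χ 1 (D.g 1) : k) = D.q := D.χ_self 1
  have h00 : (D.χ 0 (D.g 0) : k) = D.q := D.χ_self 0
  rw [map_pow, comulRep_e13, add_pow_of_skew_of_primitive D.two_le_N D.q_primitive,
    add_pow_of_skew_of_primitive D.two_le_N D.q_primitive, smul_pow,
    TensorProduct.map_pow, TensorProduct.map_pow, TensorProduct.map_pow, LinearMap.pow_mulLeft,
    LinearMap.pow_mulLeft, mul_pow_of_skew (k := k) (A := Module.End k D.R) hs, act_toLinearMap_pow, act_toLinearMap_pow,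
    ← Module.End.one_eq_id, one_pow, LinearMap.pow_mulLeft, TensorProduct.map_smul_left, smul_smul]
  -- The mixed term against the last one.
  · ext a b
    have h1 : D.e23 * (D.e13 * b) = D.qm 1 0 • (D.e13 * (D.e23 * b)) := by
      rw [← mul_assoc, e23_mul_e13, smul_mul_assoc, mul_assoc]
    simp only [TensorProduct.AlgebraTensorModule.curry_apply, LinearMap.restrictScalars_self,
      TensorProduct.curry_apply, LinearMap.smul_apply, Module.End.mul_apply,
      TensorProduct.map_tmul, LinearMap.mulLeft_apply, AlgHom.toLinearMap_apply, map_mul,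
      map_smul, AlgHom.mul_apply, act_e12, h1, D.act_comm (D.g 1) (D.g 0), smul_smul,
      smul_mul_assoc, TensorProduct.tmul_smul, ← TensorProduct.smul_tmul']
    congr 1
    rw [D.χ_self 0, show (D.χ 0 (D.g 1) : k) = D.qm 1 0 from rfl]
    ring
  -- The first term against the sum of the other two.
  · ext a b
    have h1 : ∀ a, D.e13 * (D.e12 * a) = D.qm 1 0 • (D.e12 * (D.e13 * a)) := fun a => by
      rw [← mul_assoc, e13_mul_e12, smul_mul_assoc, mul_assoc]
    simp only [TensorProduct.AlgebraTensorModule.curry_apply, LinearMap.restrictScalars_self,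
      TensorProduct.curry_apply, LinearMap.smul_apply, LinearMap.add_apply, Module.End.mul_apply,
      TensorProduct.map_tmul, LinearMap.mulLeft_apply, AlgHom.toLinearMap_apply, map_mul, map_add,
      map_smul, AlgHom.mul_apply, act_e13, h1, h00, h11, smul_add, smul_smul,
      smul_mul_assoc, ← TensorProduct.smul_tmul']
    rw [show (D.χ 0 (D.g 1) : k) = D.qm 1 0 from rfl, show (D.χ 1 (D.g 0) : k) = D.qm 0 1 from rfl]
    match_scalars
    · ring
    · linear_combination D.q * hq

/-! ### The subalgebra is a braided Hopf subalgebra. -/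

lemma act_mem_K (h : G) {z : D.R} (hz : z ∈ D.K) : D.act h z ∈ D.K := by
  suffices H : D.K ≤ D.K.comap (D.act h) from H hz
  rw [K, Algebra.adjoin_le_iff]
  rintro _ (rfl | rfl | rfl)
  · change D.act h (D.e12 ^ D.N) ∈ D.K
    rw [map_pow, act_e12, smul_pow]
    exact D.K.smul_mem D.z12_mem _
  · change D.act h (D.e13 ^ D.N) ∈ D.K
    rw [map_pow, act_e13, smul_pow]
    exact D.K.smul_mem D.z13_mem _
  · change D.act h (D.e23 ^ D.N) ∈ D.K
    rw [map_pow, act_e23, smul_pow]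
    exact D.K.smul_mem D.z23_mem _

lemma mono_mem_K (i j l : ℕ) : D.mono (i * D.N) (j * D.N) (l * D.N) ∈ D.K := by
  simp only [mono, mul_comm _ D.N, pow_mul]
  exact mul_mem (mul_mem (pow_mem D.z12_mem _) (pow_mem D.z13_mem _)) (pow_mem D.z23_mem _)

lemma coact_mem_range {z : D.R} (hz : z ∈ D.K) :
    D.coact z ∈ LinearMap.range (D.K.val.toLinearMap.lTensor (MonoidAlgebra k G)) := by
  have h := D.mem_span_mono_of_mem_K hz
  clear hz
  induction h using Submodule.span_induction with
  | mem r hr =>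
    obtain ⟨⟨i, j, l⟩, rfl⟩ := hr
    exact ⟨MonoidAlgebra.single _ (1 : k) ⊗ₜ[k] ⟨_, D.mono_mem_K i j l⟩, (D.coact_mono _ _ _).symm⟩
  | zero => rw [map_zero]; exact zero_mem _
  | add a b _ _ ha hb => rw [map_add]; exact add_mem ha hb
  | smul c a _ ha => rw [map_smul]; exact Submodule.smul_mem _ c ha

lemma map_mem_range_inclTensor {k X : Type*} [Field k] [Ring X] [Algebra k X]
    {P : Subalgebra k X} {f g : X →ₗ[k] X} (hf : ∀ x ∈ P, f x ∈ P) (hg : ∀ x ∈ P, g x ∈ P)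
    {w : X ⊗[k] X} (hw : w ∈ LinearMap.range (BraidedHopfAlgebra.inclTensor P)) :
    TensorProduct.map f g w ∈ LinearMap.range (BraidedHopfAlgebra.inclTensor P) := by
  obtain ⟨w, rfl⟩ := hw
  induction w with
  | zero => simp
  | add u v hu hv => rw [map_add, map_add]; exact add_mem hu hv
  | tmul a b => exact ⟨⟨f a, hf a a.2⟩ ⊗ₜ ⟨g b, hg b b.2⟩, rfl⟩

/-- Stated for the operators on all of K ⊗ K rather than for Δ(z) alone, so that a product of
generators is handled by composition. -/
lemma comulRep_mem_range {z : D.R} (hz : z ∈ D.K) :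
    ∀ w ∈ LinearMap.range (BraidedHopfAlgebra.inclTensor D.K),
      D.comulRep z w ∈ LinearMap.range (BraidedHopfAlgebra.inclTensor D.K) := by
  induction hz using Algebra.adjoin_induction with
  | mem x hx =>
    intro w hw
    rcases hx with rfl | rfl | rfl
    · change D.comulRep (D.x 0 ^ D.N) w ∈ _
      rw [comulRep_x_pow, LinearMap.add_apply]
      exact add_mem
        (map_mem_range_inclTensor (fun _ h => mul_mem D.z12_mem h) (fun _ h => h) hw)
        (map_mem_range_inclTensor (fun _ h => D.act_mem_K _ h) (fun _ h => mul_mem D.z12_mem h) hw)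
    · rw [comulRep_z13, LinearMap.add_apply, LinearMap.add_apply, LinearMap.smul_apply]
      exact add_mem
        (map_mem_range_inclTensor (fun _ h => mul_mem D.z13_mem h) (fun _ h => h) hw)
        (add_mem (Submodule.smul_mem _ _ (map_mem_range_inclTensor
          (fun _ h => mul_mem D.z12_mem (D.act_mem_K _ h)) (fun _ h => mul_mem D.z23_mem h) hw))
        (map_mem_range_inclTensor (fun _ h => D.act_mem_K _ h) (fun _ h => mul_mem D.z13_mem h) hw))
    · change D.comulRep (D.x 1 ^ D.N) w ∈ _
      rw [comulRep_x_pow, LinearMap.add_apply]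
      exact add_mem
        (map_mem_range_inclTensor (fun _ h => mul_mem D.z23_mem h) (fun _ h => h) hw)
        (map_mem_range_inclTensor (fun _ h => D.act_mem_K _ h) (fun _ h => mul_mem D.z23_mem h) hw)
  | algebraMap c =>
    intro w hw
    rw [AlgHom.commutes, Module.algebraMap_end_apply]
    exact Submodule.smul_mem _ c hw
  | add x y _ _ hx hy =>
    intro w hw
    rw [map_add, LinearMap.add_apply]
    exact add_mem (hx w hw) (hy w hw)
  | mul x y _ _ hx hy =>
    intro w hw
    rw [map_mul, Module.End.mul_apply]
    exact hx _ (hy w hw)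

/-- The representation of `R(V)` on itself that defines the antipode. -/
def antipodeRep : D.R →ₐ[k] Module.End k D.R := D.liftR D.antiMul fun _ _ h => D.serre_antiMul h

lemma antipodeR_eq (r : D.R) : D.antipodeR r = D.antipodeRep r 1 := rfl

lemma antipodeR_mul (r s : D.R) : D.antipodeR (r * s) = D.antipodeRep r (D.antipodeR s) := by
  simp [antipodeR_eq]

/-- `S(r s) = S(h s) S(r)` whenever `r` has degree `h`; this says that `r` behaves like
an element of degree `h`. -/
def IsAntiHom (h : G) (r : D.R) : Prop := ∀ s, D.antipodeRep r s = D.act h s * D.antipodeR r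

variable {D}

lemma IsAntiHom.mul {h h' : G} {r r' : D.R} (hr : D.IsAntiHom h r) (hr' : D.IsAntiHom h' r') :
    D.IsAntiHom (h * h') (r * r') := by
  intro s
  rw [map_mul, Module.End.mul_apply, hr', hr, antipodeR_mul, hr, map_mul, map_mul, AlgHom.mul_apply,
    mul_assoc]

lemma IsAntiHom.pow {h : G} {r : D.R} (hr : D.IsAntiHom h r) (n : ℕ) :
    D.IsAntiHom (h ^ n) (r ^ n) := by
  induction n with
  | zero => intro s; simp [antipodeR_one]
  | succ n ih => rw [pow_succ, pow_succ]; exact ih.mul hr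

variable (D)

lemma isAntiHom_x (i : Fin 2) : D.IsAntiHom (D.g i) (D.x i) := by
  intro s
  simp [antipodeR_eq, antipodeRep]

/-- Both monomials of `e13` have the same degree because G is abelian. -/
lemma isAntiHom_e13 : D.IsAntiHom (D.g 0 * D.g 1) D.e13 := by
  intro s
  have h0 := (D.isAntiHom_x 0).mul (D.isAntiHom_x 1) s
  have h1 := (D.isAntiHom_x 1).mul (D.isAntiHom_x 0) s
  rw [mul_comm (D.g 1)] at h1
  simp only [e13, map_sub, map_smul, LinearMap.sub_apply, LinearMap.smul_apply, mul_sub,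
    mul_smul_comm, h0, h1]

lemma antipodeR_x_pow_mem (i : Fin 2) (hi : D.x i ^ D.N ∈ D.K) : D.antipodeR (D.x i ^ D.N) ∈ D.K := by
  have h : ∀ n, ∃ c : k, D.antipodeR (D.x i ^ n) = c • D.x i ^ n := by
    intro n
    induction n with
    | zero => exact ⟨1, by simp [antipodeR_one]⟩
    | succ n ih =>
      obtain ⟨c, hc⟩ := ih
      refine ⟨-(c * (D.χ i (D.g i) : k) ^ n), ?_⟩
      rw [pow_succ', antipodeR_x_mul, hc, map_smul, map_pow, act_x, smul_pow, smul_smul,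
        smul_mul_assoc, ← pow_succ, ← pow_succ', neg_smul]
  obtain ⟨c, hc⟩ := h D.N
  rw [hc]
  exact D.K.smul_mem hi c

lemma counitHom_e12 : D.counitHom D.e12 = 0 := D.counitHom_x 0

lemma counitHom_e23 : D.counitHom D.e23 = 0 := D.counitHom_x 1

lemma counitHom_e13 : D.counitHom D.e13 = 0 := by
  simp [e13_eq, counitHom_e12, counitHom_e23]

lemma comulR_z13 : D.comulR (D.e13 ^ D.N) = (D.e13 ^ D.N) ⊗ₜ 1
    + (((1 - D.q⁻¹) ^ D.N * D.qm 1 0 ^ D.N.choose 2) • (D.e12 ^ D.N) ⊗ₜ (D.e23 ^ D.N)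
      + 1 ⊗ₜ (D.e13 ^ D.N)) := by
  rw [comulR_eq, comulRep_z13]
  simp

/-- Instead of computing S(z₁₃), one solves the antipode axiom for it: Δ(z₁₃) expresses it through
S(z₁₂) z₂₃ and z₁₃. -/
lemma antipodeR_z13_mem : D.antipodeR (D.e13 ^ D.N) ∈ D.K := by
  have h : LinearMap.mul' k D.R (D.antipodeR.rTensor D.R (D.comulR (D.e13 ^ D.N)))
      = algebraMap k D.R (D.counitHom (D.e13 ^ D.N)) :=
    D.hopf.mul_antipode_rTensor_comul (D.e13 ^ D.N)
  rw [comulR_z13, map_pow, counitHom_e13, zero_pow D.N_pos.ne', map_zero] at h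
  simp only [map_add, map_smul, LinearMap.rTensor_tmul, LinearMap.mul'_apply, mul_one,
    antipodeR_one, one_mul] at h
  rw [eq_neg_of_add_eq_zero_left h]
  exact neg_mem (add_mem (D.K.smul_mem (mul_mem (D.antipodeR_x_pow_mem 0 D.z12_mem) D.z23_mem) _)
    D.z13_mem)

lemma antipodeRep_mem {z : D.R} (hz : z ∈ D.K) : ∀ s ∈ D.K, D.antipodeRep z s ∈ D.K := by
  induction hz using Algebra.adjoin_induction with
  | mem x hx =>
    intro s hs
    rcases hx with rfl | rfl | rfl
    · rw [e12, (D.isAntiHom_x 0).pow D.N s]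
      exact mul_mem (D.act_mem_K _ hs) (D.antipodeR_x_pow_mem 0 D.z12_mem)
    · rw [D.isAntiHom_e13.pow D.N s]
      exact mul_mem (D.act_mem_K _ hs) D.antipodeR_z13_mem
    · rw [e23, (D.isAntiHom_x 1).pow D.N s]
      exact mul_mem (D.act_mem_K _ hs) (D.antipodeR_x_pow_mem 1 D.z23_mem)
  | algebraMap c =>
    intro w hw
    rw [AlgHom.commutes, Module.algebraMap_end_apply]
    exact D.K.smul_mem hw c
  | add x y _ _ hx hy =>
    intro w hw
    rw [map_add, LinearMap.add_apply]
    exact add_mem (hx w hw) (hy w hw)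
  | mul x y _ _ hx hy =>
    intro w hw
    rw [map_mul, Module.End.mul_apply]
    exact hx _ (hy w hw)

lemma isHopfSubalgebra_K : D.hopf.IsHopfSubalgebra D.K where
  act_mem h _ hz := D.act_mem_K h hz
  coact_mem _ hz := D.coact_mem_range hz
  comul_mem _ hz := D.comulRep_mem_range hz _ ⟨1 ⊗ₜ 1, rfl⟩
  antipode_mem _ hz := D.antipodeRep_mem hz 1 (one_mem _)

/-! ### The algebra as a module over its subalgebra of N-th powers. -/

/-- The PBW monomials of `K(V)`. -/
def zmono (i j l : ℕ) : D.K := ⟨D.mono (i * D.N) (j * D.N) (l * D.N), D.mono_mem_K i j l⟩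

lemma zmono_eq (i j l : ℕ) :
    (D.zmono i j l : D.R) = (D.e12 ^ D.N) ^ i * (D.e13 ^ D.N) ^ j * (D.e23 ^ D.N) ^ l := by
  simp only [zmono, mono, mul_comm _ D.N, pow_mul]

/-- Up to a nonzero scalar, division of the exponents with remainder by N factors every PBW monomial
uniquely into a restricted one and one in `K`. -/
lemma mono_mul_zmono (m n l i j h : ℕ) : D.mono m n l * D.zmono i j h
    = (D.qm 1 0 ^ D.N) ^ (i * (n + l) + j * l)
      • D.mono (m + i * D.N) (n + j * D.N) (l + h * D.N) := by
  have h1 : ∀ i m, D.mono m n l * (D.e12 ^ D.N) ^ i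
      = (D.qm 1 0 ^ D.N) ^ (i * (n + l)) • D.mono (m + i * D.N) n l := by
    intro i
    induction i with
    | zero => simp
    | succ i ih =>
      intro m
      rw [pow_succ', ← mul_assoc, mono_mul_z12, smul_mul_assoc, ih, smul_smul, ← pow_add]
      congr 2 <;> ring
  have h2 : ∀ j m n, D.mono m n l * (D.e13 ^ D.N) ^ j
      = (D.qm 1 0 ^ D.N) ^ (j * l) • D.mono m (n + j * D.N) l := by
    intro j
    induction j with
    | zero => simp
    | succ j ih =>
      intro m n
      rw [pow_succ', ← mul_assoc, mono_mul_z13, smul_mul_assoc, ih, smul_smul, ← pow_add]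
      congr 2 <;> ring
  have h3 : ∀ h m n l, D.mono m n l * (D.e23 ^ D.N) ^ h = D.mono m n (l + h * D.N) := by
    intro h
    induction h with
    | zero => simp
    | succ h ih =>
      intro m n l
      rw [pow_succ', ← mul_assoc, mono_mul_z23, ih]
      congr 1; ring
  rw [zmono_eq, ← mul_assoc, ← mul_assoc, h1, smul_mul_assoc, smul_mul_assoc, h2, smul_mul_assoc,
    h3, smul_smul, ← pow_add]

lemma zmono_mul_mono (m n l i j h : ℕ) : D.zmono i j h * D.mono m n l
    = (D.qm 1 0 ^ D.N) ^ (h * (m + n) + j * m)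
      • D.mono (m + i * D.N) (n + j * D.N) (l + h * D.N) := by
  have h1 : ∀ i m n l, (D.e12 ^ D.N) ^ i * D.mono m n l = D.mono (m + i * D.N) n l := by
    intro i
    induction i with
    | zero => simp
    | succ i ih =>
      intro m n l
      rw [pow_succ, mul_assoc, z12_mul_mono, ih]
      congr 1; ring
  have h2 : ∀ j n l, (D.e13 ^ D.N) ^ j * D.mono m n l
      = (D.qm 1 0 ^ D.N) ^ (j * m) • D.mono m (n + j * D.N) l := by
    intro j
    induction j with
    | zero => simp
    | succ j ih =>
      intro n l
      rw [pow_succ, mul_assoc, z13_mul_mono, mul_smul_comm, ih, smul_smul, ← pow_add]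
      congr 2 <;> ring
  have h3 : ∀ h l, (D.e23 ^ D.N) ^ h * D.mono m n l
      = (D.qm 1 0 ^ D.N) ^ (h * (m + n)) • D.mono m n (l + h * D.N) := by
    intro h
    induction h with
    | zero => simp
    | succ h ih =>
      intro l
      rw [pow_succ, mul_assoc, z23_mul_mono, mul_smul_comm, ih, smul_smul, ← pow_add]
      congr 2 <;> ring
  rw [zmono_eq, mul_assoc, mul_assoc, h3, mul_smul_comm, mul_smul_comm, h2, mul_smul_comm, h1,
    smul_smul, ← pow_add]

lemma rho_ne_zero (n : ℕ) : (D.qm 1 0 ^ D.N) ^ n ≠ 0 := pow_ne_zero _ (pow_ne_zero _ (D.qm_ne_zero 1 0))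

lemma K_span_induction {p : D.K → Prop} (add : ∀ a b, p a → p b → p (a + b))
    (smul : ∀ (c : k) a, p a → p (c • a)) (zmono : ∀ i j l, p (D.zmono i j l)) (z : D.K) : p z := by
  obtain ⟨z, hz⟩ := z
  suffices H : ∃ hz : z ∈ D.K, p ⟨z, hz⟩ from H.2
  have h := D.mem_span_mono_of_mem_K hz
  clear hz
  induction h using Submodule.span_induction with
  | mem r hr => obtain ⟨⟨i, j, l⟩, rfl⟩ := hr; exact ⟨_, zmono i j l⟩
  | zero => 
    have h := smul 0 _ (zmono 0 0 0)
    rw [zero_smul] at h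
    exact ⟨zero_mem _, h⟩
  | add a b _ _ ha hb => exact ⟨add_mem ha.1 hb.1, add _ _ ha.2 hb.2⟩
  | smul c a _ ha => exact ⟨D.K.smul_mem ha.1 c, smul c _ ha.2⟩

/-- `R(V)` is generated as a right `K(V)`-module by the restricted PBW monomials. -/
lemma restricted_induction {p : D.R → Prop} (add : ∀ a b, p a → p b → p (a + b))
    (smul : ∀ (c : k) a, p a → p (c • a))
    (mono_mul : ∀ m n l, m < D.N → n < D.N → l < D.N → ∀ z : D.K, p (D.mono m n l * z))
    (r : D.R) : p r := by
  have hr : r ∈ Submodule.span k (Set.range fun t : ℕ × ℕ × ℕ => D.mono t.1 t.2.1 t.2.2) :=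
    D.span_mono ▸ Submodule.mem_top
  induction hr using Submodule.span_induction with
  | mem r hr =>
    obtain ⟨⟨m, n, l⟩, rfl⟩ := hr
    have h := D.mono_mul_zmono (m % D.N) (n % D.N) (l % D.N) (m / D.N) (n / D.N) (l / D.N)
    simp only [Nat.mod_add_div'] at h
    rw [← inv_smul_eq_iff₀ (D.rho_ne_zero _)] at h
    change p (D.mono m n l)
    rw [← h]
    exact smul _ _ (mono_mul _ _ _ (Nat.mod_lt m D.N_pos) (Nat.mod_lt n D.N_pos)
      (Nat.mod_lt l D.N_pos) (D.zmono (m / D.N) (n / D.N) (l / D.N)))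
  | zero => simpa using smul 0 _ (mono_mul 0 0 0 D.N_pos D.N_pos D.N_pos 1)
  | add a b _ _ ha hb => exact add _ _ ha hb
  | smul c a _ ha => exact smul c a ha

/-- `R(V)` is generated as a left `K(V)`-module by the restricted PBW monomials. -/
lemma restricted_induction_left {p : D.R → Prop} (add : ∀ a b, p a → p b → p (a + b))
    (smul : ∀ (c : k) a, p a → p (c • a))
    (mul_mono : ∀ m n l, m < D.N → n < D.N → l < D.N → ∀ z ∈ D.K, p (z * D.mono m n l))
    (r : D.R) : p r := by
  induction r using D.restricted_induction with
  | add a b ha hb => exact add a b ha hb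
  | smul c a ha => exact smul c a ha
  | mono_mul m n l hm hn hl z =>
    induction z using D.K_span_induction with
    | add a b ha hb => rw [Subalgebra.coe_add, mul_add]; exact add _ _ ha hb
    | smul c a ha => rw [Subalgebra.coe_smul, mul_smul_comm]; exact smul _ _ ha
    | zmono i j h =>
      have h1 := D.zmono_mul_mono m n l i j h
      rw [← inv_smul_eq_iff₀ (D.rho_ne_zero _)] at h1
      rw [mono_mul_zmono, ← h1]
      exact smul _ _ (smul _ _ (mul_mono m n l hm hn hl _ (D.zmono i j h).2))

lemma counitHom_mono (m n l : ℕ) : D.counitHom (D.mono m n l)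
    = if m = 0 ∧ n = 0 ∧ l = 0 then 1 else 0 := by
  simp only [mono, map_mul, map_pow, counitHom_e12, counitHom_e13, counitHom_e23]
  rcases m with _ | m <;> rcases n with _ | n <;> rcases l with _ | l <;> simp

/-! ### Existence and uniqueness of the deformed retraction. -/

/-- The coefficient of `z₁₃ z` in the value of the deformed retraction at
`e₁₂ᵐ e₁₃ⁿ e₂₃ˡ z`. -/
def defCoeff (m n l : ℕ) : k :=
  if m = l ∧ m + n = D.N then
    (1 - D.q⁻¹) ^ ((n : ℤ) - (D.N : ℤ)) * D.qm 1 0 ^ ((n.choose 2 : ℤ) - (D.N.choose 2 : ℤ))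
  else 0

lemma isDeformedRetraction_iff {u : D.R →ₗ[k] D.K} : D.IsDeformedRetraction u ↔
    ∀ m n l : ℕ, m < D.N → n < D.N → l < D.N → ∀ z : D.K, u (D.mono m n l * z)
      = D.counitHom (D.mono m n l) • z + D.defCoeff m n l • (D.z13 * z) := by
  have h : ∀ m n l (z : D.K), D.defCoeff m n l • (D.z13 * z) = if m = l ∧ m + n = D.N then
            ((1 - D.q⁻¹) ^ ((n : ℤ) - (D.N : ℤ))
              * (D.χ 0 (D.g 1) : k) ^ ((n.choose 2 : ℤ) - (D.N.choose 2 : ℤ))) • (D.z13 * z)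
          else 0 := by
    intro m n l z
    rw [defCoeff, ite_smul, zero_smul]
    rfl
  simp only [h]
  rfl

/-- The deformed retraction, defined on the PBW basis. -/
def deformedRetraction : D.R →ₗ[k] D.K :=
  D.pbw.constr k fun t =>
    -- The inverse of the scalar in `mono_mul_zmono`: the basis monomial is this multiple of
    -- (restricted monomial) · (monomial in `K`), with exponents given by remainder and quotient.
    ((D.qm 1 0 ^ D.N) ^ (t.1 / D.N * (t.2.1 % D.N + t.2.2 % D.N) + t.2.1 / D.N * (t.2.2 % D.N)))⁻¹ •
      (D.counitHom (D.mono (t.1 % D.N) (t.2.1 % D.N) (t.2.2 % D.N)) •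
          D.zmono (t.1 / D.N) (t.2.1 / D.N) (t.2.2 / D.N)
        + D.defCoeff (t.1 % D.N) (t.2.1 % D.N) (t.2.2 % D.N) •
          (D.z13 * D.zmono (t.1 / D.N) (t.2.1 / D.N) (t.2.2 / D.N)))

lemma isDeformedRetraction_deformedRetraction : D.IsDeformedRetraction D.deformedRetraction := by
  rw [isDeformedRetraction_iff]
  intro m n l hm hn hl z
  induction z using D.K_span_induction with
  | add a b ha hb =>
    rw [Subalgebra.coe_add, mul_add, map_add, ha, hb, mul_add]
    module
  | smul c a ha =>
    rw [Subalgebra.coe_smul, mul_smul_comm, map_smul, ha, mul_smul_comm]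
    module
  | zmono i j h =>
    have h1 : ∀ {m i}, m < D.N → (m + i * D.N) / D.N = i := fun {m i} hm => by
      rw [Nat.add_mul_div_right _ _ D.N_pos, Nat.div_eq_of_lt hm, zero_add]
    have h2 : ∀ {m i}, m < D.N → (m + i * D.N) % D.N = m := fun {m i} hm => by
      rw [Nat.add_mul_mod_self_right, Nat.mod_eq_of_lt hm]
    rw [mono_mul_zmono, map_smul, deformedRetraction, ← pbw_apply, Module.Basis.constr_basis]
    simp only [h1 hm, h1 hn, h1 hl, h2 hm, h2 hn, h2 hl]
    rw [smul_inv_smul₀ (D.rho_ne_zero _)]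

lemma existsUnique_isDeformedRetraction : ∃! u : D.R →ₗ[k] D.K, D.IsDeformedRetraction u := by
  refine ⟨_, D.isDeformedRetraction_deformedRetraction, fun u hu => LinearMap.ext fun r => ?_⟩
  have hu' := D.isDeformedRetraction_deformedRetraction
  replace hu : D.IsDeformedRetraction u := hu
  rw [isDeformedRetraction_iff] at hu hu'
  induction r using D.restricted_induction with
  | add a b ha hb => rw [map_add, map_add, ha, hb]
  | smul c a ha => rw [map_smul, map_smul, ha]
  | mono_mul m n l hm hn hl z => rw [hu m n l hm hn hl, hu' m n l hm hn hl]

end DiagramA2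

/-! ### Linearity over the subalgebra, counit, action and coaction. -/

namespace DiagramA2

variable {k G : Type*} [Field k] [CommGroup G] {D : DiagramA2 k G} {u : D.R →ₗ[k] D.K}

/-- Scalars have to be compared only on the support of the correction term, where the monomial has
the bidegree of z₁₃. -/
lemma defCoeff_smul_eq {m n l : ℕ} {M : Type*} [AddCommGroup M] [Module k M] {a b : M}
    (h : m = l → m + n = D.N → a = b) : D.defCoeff m n l • a = D.defCoeff m n l • b := by
  by_cases hc : m = l ∧ m + n = D.N
  · rw [h hc.1 hc.2]
  · rw [defCoeff, if_neg hc, zero_smul, zero_smul]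

lemma counitHom_mono_smul_eq {m n l : ℕ} {M : Type*} [AddCommGroup M] [Module k M] {a b : M}
    (h : m = 0 → n = 0 → l = 0 → a = b) :
    D.counitHom (D.mono m n l) • a = D.counitHom (D.mono m n l) • b := by
  rw [counitHom_mono]
  split_ifs with hc
  · rw [h hc.1 hc.2.1 hc.2.2]
  · rw [zero_smul, zero_smul]

namespace IsDeformedRetraction

lemma apply_mono_mul (hu : D.IsDeformedRetraction u) {m n l : ℕ} (hm : m < D.N) (hn : n < D.N)
    (hl : l < D.N) {z : D.R} (hz : z ∈ D.K) : (u (D.mono m n l * z) : D.R)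
      = D.counitHom (D.mono m n l) • z + D.defCoeff m n l • (D.e13 ^ D.N * z) := by
  rw [isDeformedRetraction_iff] at hu
  exact congrArg Subtype.val (hu m n l hm hn hl ⟨z, hz⟩)

lemma apply_coe (hu : D.IsDeformedRetraction u) {z : D.R} (hz : z ∈ D.K) : (u z : D.R) = z := by
  have h := hu.apply_mono_mul D.N_pos D.N_pos D.N_pos hz
  rw [mono_zero, one_mul, map_one, one_smul, defCoeff, if_neg, zero_smul, add_zero] at h
  · exact h
  · have := D.N_pos
    omega

lemma apply_mul_coe (hu : D.IsDeformedRetraction u) {z : D.R} (hz : z ∈ D.K) (r : D.R) :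
    (u (r * z) : D.R) = u r * z := by
  induction r using D.restricted_induction with
  | add a b ha hb => simp only [add_mul, map_add, Subalgebra.coe_add, ha, hb]
  | smul c a ha => simp only [smul_mul_assoc, map_smul, Subalgebra.coe_smul, ha]
  | mono_mul m n l hm hn hl y =>
    rw [mul_assoc, hu.apply_mono_mul hm hn hl (mul_mem y.2 hz), hu.apply_mono_mul hm hn hl y.2,
      add_mul, smul_mul_assoc, smul_mul_assoc, mul_assoc]

/-- Moving ζ past the restricted monomial costs σ. The naive term needs σ = 1 at the monomial 1, and
the correction term needs σ to be the cost of moving ζ past z₁₃. -/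
lemma apply_mul_of_skew (hu : D.IsDeformedRetraction u) {ζ : D.R} (hζ : ζ ∈ D.K)
    (σ : ℕ → ℕ → ℕ → k) (h : ∀ m n l, ζ * D.mono m n l = σ m n l • (D.mono m n l * ζ))
    (h0 : σ 0 0 0 = 1) (h1 : ∀ m n, m + n = D.N →
      σ m n m • (D.e13 ^ D.N * ζ) = ζ * D.e13 ^ D.N) (r : D.R) :
    (u (ζ * r) : D.R) = ζ * u r := by
  induction r using D.restricted_induction with
  | add a b ha hb => simp only [mul_add, map_add, Subalgebra.coe_add, ha, hb]
  | smul c a ha => simp only [mul_smul_comm, map_smul, Subalgebra.coe_smul, ha]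
  | mono_mul m n l hm hn hl y =>
    rw [← mul_assoc, h, smul_mul_assoc, mul_assoc, map_smul, Subalgebra.coe_smul,
      hu.apply_mono_mul hm hn hl (mul_mem hζ y.2), hu.apply_mono_mul hm hn hl y.2, mul_add,
      mul_smul_comm, mul_smul_comm, smul_add, smul_comm (σ m n l), smul_comm (σ m n l)]
    congr 1
    · refine counitHom_mono_smul_eq fun hm hn hl => ?_
      rw [hm, hn, hl, h0, one_smul]
    · refine defCoeff_smul_eq fun hml hmn => ?_
      rw [← hml, ← mul_assoc, ← mul_assoc, ← h1 m n hmn, smul_mul_assoc]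

lemma apply_coe_mul (hu : D.IsDeformedRetraction u) {z : D.R} (hz : z ∈ D.K) (r : D.R) :
    (u (z * r) : D.R) = z * u r := by
  have h12 := pow_mul_pow_of_skew D.e13_mul_e12 D.N D.N
  have h23 := pow_mul_pow_of_skew D.e23_mul_e13 D.N D.N
  induction hz using Algebra.adjoin_induction generalizing r with
  | mem x hx =>
    rcases hx with rfl | rfl | rfl
    -- On the support n + l = N, so the scalar becomes ρ⁻ᴺ, the one relating z₁₂ and z₁₃. For z₁₃
    -- below, the factors ρᵐ and ρ⁻ˡ cancel because m = l. For z₂₃ the exponent is m + n = N.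
    · refine hu.apply_mul_of_skew D.z12_mem (fun m n l => ((D.qm 1 0 ^ D.N) ^ (n + l))⁻¹) ?_
        (by simp) ?_ r
      · intro m n l
        rw [mono_mul_z12, inv_smul_smul₀ (D.rho_ne_zero _), z12_mul_mono]
      · intro m n hmn
        rw [h12, add_comm n, hmn, ← pow_mul, inv_smul_smul₀ (pow_ne_zero _ (D.qm_ne_zero 1 0))]
    · refine hu.apply_mul_of_skew D.z13_mem
        (fun m n l => (D.qm 1 0 ^ D.N) ^ m * ((D.qm 1 0 ^ D.N) ^ l)⁻¹) ?_ (by simp) ?_ r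
      · intro m n l
        rw [mono_mul_z13, mul_smul, inv_smul_smul₀ (D.rho_ne_zero _), z13_mul_mono]
      · intro m n hmn
        rw [mul_inv_cancel₀ (D.rho_ne_zero _), one_smul]
    · refine hu.apply_mul_of_skew D.z23_mem (fun m n l => (D.qm 1 0 ^ D.N) ^ (m + n)) ?_
        (by simp) ?_ r
      · intro m n l
        rw [mono_mul_z23, z23_mul_mono]
      · intro m n hmn
        rw [h23, hmn, ← pow_mul]
  | algebraMap c => rw [← Algebra.smul_def, ← Algebra.smul_def, map_smul, Subalgebra.coe_smul]
  | add x y _ _ hx hy =>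
    rw [add_mul, map_add, Subalgebra.coe_add, hx, hy, add_mul]
  | mul x y _ _ hx hy => rw [mul_assoc, hx, hy, mul_assoc]

/-- The counit kills z₁₃ and hence does not see the correction term. -/
lemma counitHom_apply (hu : D.IsDeformedRetraction u) (r : D.R) :
    D.counitHom (u r) = D.counitHom r := by
  induction r using D.restricted_induction with
  | add a b ha hb => simp only [map_add, Subalgebra.coe_add, ha, hb]
  | smul c a ha => simp only [map_smul, Subalgebra.coe_smul, ha]
  | mono_mul m n l hm hn hl y =>
    rw [hu.apply_mono_mul hm hn hl y.2, map_add, map_smul, map_smul, map_mul, map_mul, map_pow,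
      counitHom_e13, zero_pow D.N_pos.ne', zero_mul, smul_zero, add_zero, smul_eq_mul]

/-- On the support of the correction term, e₁₂ᵐ e₁₃ⁿ e₂₃ˡ has degree N in both generators, so G acts
on it by the same character as on z₁₃. The coaction is treated in the same way. -/
lemma apply_act (hu : D.IsDeformedRetraction u) (h : G) (r : D.R) :
    (u (D.act h r) : D.R) = D.act h (u r) := by
  induction r using D.restricted_induction with
  | add a b ha hb => simp only [map_add, Subalgebra.coe_add, ha, hb]
  | smul c a ha => simp only [map_smul, Subalgebra.coe_smul, ha]
  | mono_mul m n l hm hn hl y =>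
    rw [hu.apply_mono_mul hm hn hl y.2, map_mul, act_mono, smul_mul_assoc, map_smul,
      Subalgebra.coe_smul, hu.apply_mono_mul hm hn hl (D.act_mem_K h y.2), map_add, map_smul,
      map_smul, map_mul, map_pow, act_e13, smul_pow, smul_mul_assoc, smul_add, smul_comm _ (D.counitHom _),
      smul_comm _ (D.defCoeff _ _ _)]
    congr 1
    · refine counitHom_mono_smul_eq fun hm hn hl => ?_
      simp [hm, hn, hl]
    · refine defCoeff_smul_eq fun hml hmn => ?_
      rw [← hml, add_comm n, hmn, mul_pow]

lemma coact_apply (hu : D.IsDeformedRetraction u) (r : D.R) : D.coact (u r)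
    = (D.K.val.toLinearMap ∘ₗ u).lTensor (MonoidAlgebra k G) (D.coact r) := by
  induction r using D.restricted_induction with
  | add a b ha hb => simp only [map_add, Subalgebra.coe_add, ha, hb]
  | smul c a ha => simp only [map_smul, Subalgebra.coe_smul, ha]
  | mono_mul m n l hm hn hl y =>
    obtain ⟨w, hw⟩ := D.coact_mem_range y.2
    rw [hu.apply_mono_mul hm hn hl y.2, map_mul, coact_mono, map_add, map_smul, map_smul, map_mul,
      map_pow, coact_e13, Algebra.TensorProduct.tmul_pow, MonoidAlgebra.single_pow, one_pow, ← hw]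
    clear hw
    induction w with
    | zero => simp
    | add v w hv hw =>
      simp only [map_add, mul_add, smul_add, ← hv, ← hw]
      abel
    | tmul a b =>
      simp only [LinearMap.lTensor_tmul, Algebra.TensorProduct.tmul_mul_tmul,
        LinearMap.comp_apply, AlgHom.toLinearMap_apply, Subalgebra.coe_val,
        hu.apply_mono_mul hm hn hl b.2, TensorProduct.tmul_add, TensorProduct.tmul_smul]
      congr 1
      · refine counitHom_mono_smul_eq (D := D) (M := MonoidAlgebra k G ⊗[k] D.R) fun hm hn hl => ?_
        rw [hm, hn, hl, add_zero, pow_zero, pow_zero, one_mul, ← MonoidAlgebra.one_def, one_mul]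
      · refine defCoeff_smul_eq (D := D) (M := MonoidAlgebra k G ⊗[k] D.R) fun hml hmn => ?_
        rw [← hml, add_comm n, hmn, mul_pow]

end IsDeformedRetraction

end DiagramA2

/-! ### The bidegree of the comultiplication. -/

namespace DiagramA2

variable {k G : Type*} [Field k] [CommGroup G] (D : DiagramA2 k G)

/-- The component of `R(V) ⊗ R(V)` of total degree `α` in `x₀` and `β` in `x₁`. -/
def tensorDeg (α β : ℕ) : Submodule k (D.R ⊗[k] D.R) :=
  Submodule.span k {w | ∃ m n l m' n' l' : ℕ, m + n + (m' + n') = α ∧ n + l + (n' + l') = β ∧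
    w = D.mono m n l ⊗ₜ D.mono m' n' l'}

variable {D}

lemma tmul_mem_tensorDeg {m n l m' n' l' α β : ℕ} (hα : m + n + (m' + n') = α)
    (hβ : n + l + (n' + l') = β) : D.mono m n l ⊗ₜ D.mono m' n' l' ∈ D.tensorDeg α β :=
  Submodule.subset_span ⟨m, n, l, m', n', l', hα, hβ, rfl⟩

lemma map_mem_tensorDeg {f : Module.End k (D.R ⊗[k] D.R)} {a b : ℕ}
    (h : ∀ m n l m' n' l', f (D.mono m n l ⊗ₜ D.mono m' n' l')
      ∈ D.tensorDeg (m + n + (m' + n') + a) (n + l + (n' + l') + b)) {α β : ℕ}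
    {w : D.R ⊗[k] D.R} (hw : w ∈ D.tensorDeg α β) : f w ∈ D.tensorDeg (α + a) (β + b) := by
  induction hw using Submodule.span_induction with
  | mem w hw =>
    obtain ⟨m, n, l, m', n', l', rfl, rfl, rfl⟩ := hw
    exact h m n l m' n' l'
  | zero => rw [map_zero]; exact zero_mem _
  | add v w _ _ hv hw => rw [map_add]; exact add_mem hv hw
  | smul c w _ hw => rw [map_smul]; exact Submodule.smul_mem _ c hw

lemma comulRep_e12_mem {α β : ℕ} {w : D.R ⊗[k] D.R} (hw : w ∈ D.tensorDeg α β) :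
    D.comulRep D.e12 w ∈ D.tensorDeg (α + 1) β := by
  refine map_mem_tensorDeg (b := 0) (fun m n l m' n' l' => ?_) hw
  have h0 : D.comulRep D.e12 = D.primMul 0 := D.comulRep_x 0
  rw [h0, primMul_tmul, ← e12, e12_mul_mono, e12_mul_mono, act_mono, ← TensorProduct.smul_tmul']
  exact add_mem (tmul_mem_tensorDeg (by ring) (by ring))
    (Submodule.smul_mem _ _ (tmul_mem_tensorDeg (by ring) (by ring)))

lemma comulRep_e23_mem {α β : ℕ} {w : D.R ⊗[k] D.R} (hw : w ∈ D.tensorDeg α β) :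
    D.comulRep D.e23 w ∈ D.tensorDeg α (β + 1) := by
  refine map_mem_tensorDeg (a := 0) (fun m n l m' n' l' => ?_) hw
  have h1 : D.comulRep D.e23 = D.primMul 1 := D.comulRep_x 1
  rw [h1, primMul_tmul, ← e23, e23_mul_mono, e23_mul_mono, act_mono, ← TensorProduct.smul_tmul',
    TensorProduct.sub_tmul, TensorProduct.tmul_sub, ← TensorProduct.smul_tmul',
    ← TensorProduct.smul_tmul', TensorProduct.tmul_smul, TensorProduct.tmul_smul]
  refine add_mem (sub_mem (Submodule.smul_mem _ _ (tmul_mem_tensorDeg (by ring) (by ring))) ?_)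
    (Submodule.smul_mem _ _ (sub_mem (Submodule.smul_mem _ _
      (tmul_mem_tensorDeg (by ring) (by ring))) ?_))
  -- The truncated exponent m - 1 would break the degree count at m = 0, but there the coefficient
  -- `comCoeff 0` is zero.
  · cases m with
    | zero => simp
    | succ m => exact Submodule.smul_mem _ _ (tmul_mem_tensorDeg (by simp; ring) (by ring))
  · cases m' with
    | zero => simp
    | succ m' => exact Submodule.smul_mem _ _ (tmul_mem_tensorDeg (by simp; ring) (by ring))

lemma comulRep_e13_mem {α β : ℕ} {w : D.R ⊗[k] D.R} (hw : w ∈ D.tensorDeg α β) :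
    D.comulRep D.e13 w ∈ D.tensorDeg (α + 1) (β + 1) := by
  rw [e13_eq, map_sub, map_smul, map_mul, map_mul]
  exact sub_mem (comulRep_e12_mem (comulRep_e23_mem hw))
    (Submodule.smul_mem _ _ (comulRep_e23_mem (comulRep_e12_mem hw)))

/-- Left multiplication by Δ(e₁₂), Δ(e₁₃) and Δ(e₂₃) raises the bidegree by (1, 0), (1, 1) and (0,
1). -/
lemma comulR_mono_mem (m n l : ℕ) : D.comulR (D.mono m n l) ∈ D.tensorDeg (m + n) (n + l) := by
  have hl : ∀ l, (D.comulRep D.e23 ^ l) (1 ⊗ₜ 1) ∈ D.tensorDeg 0 l := by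
    intro l
    induction l with
    | zero =>
      have h : D.mono 0 0 0 ⊗ₜ D.mono 0 0 0 ∈ D.tensorDeg 0 0 := tmul_mem_tensorDeg rfl rfl
      simpa using h
    | succ l ih => rw [pow_succ', Module.End.mul_apply]; exact comulRep_e23_mem ih
  have hn : ∀ n w, w ∈ D.tensorDeg 0 l → (D.comulRep D.e13 ^ n) w ∈ D.tensorDeg n (n + l) := by
    intro n w hw
    induction n with
    | zero => simpa using hw
    | succ n ih =>
      rw [pow_succ', Module.End.mul_apply, add_right_comm]
      exact comulRep_e13_mem ih
  have hm : ∀ m w, w ∈ D.tensorDeg n (n + l) →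
      (D.comulRep D.e12 ^ m) w ∈ D.tensorDeg (m + n) (n + l) := by
    intro m w hw
    induction m with
    | zero => simpa using hw
    | succ m ih =>
      rw [pow_succ', Module.End.mul_apply, add_right_comm]
      exact comulRep_e12_mem ih
  rw [comulR_eq, mono, map_mul, map_mul, map_pow, map_pow, map_pow]
  exact hm m _ (hn n _ (hl l))

variable (D)

/-! ### The coefficients of x₀ᴺ ⊗ x₁ᴺ and x₁ᴺ ⊗ x₀ᴺ in the comultiplication. -/

/-- The algebra map `R(V) → k[X]` which sends `xᵢ` to `X` and the other generator to `0`. -/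
def toPoly (i : Fin 2) : D.R →ₐ[k] Polynomial k :=
  D.liftR (Pi.single i Polynomial.X) fun a b hab => by
    have h : ∀ j, j ≠ i → (Pi.single i Polynomial.X : Fin 2 → Polynomial k) j = 0 :=
      fun j hj => Pi.single_eq_of_ne hj _
    -- Every term of the Serre expression contains both generators, and one of them is sent to 0.
    have hc : a ≠ i ∨ b ≠ i := by omega
    rcases hc with hc | hc <;> simp [serreExpr, h _ hc]

lemma toPoly_x_self (i : Fin 2) : D.toPoly i (D.x i) = Polynomial.X := by
  simp [toPoly]

lemma toPoly_x_ne {i j : Fin 2} (h : j ≠ i) : D.toPoly i (D.x j) = 0 := by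
  simp [toPoly, h]

lemma toPoly_e13 (i : Fin 2) : D.toPoly i D.e13 = 0 := by
  fin_cases i <;> simp [e13, toPoly_x_ne]

/-- The coefficient of `xᵢᴺ`. -/
def powCoeff (i : Fin 2) : D.R →ₗ[k] k := Polynomial.lcoeff k D.N ∘ₗ (D.toPoly i).toLinearMap

lemma powCoeff_zero_mono (m n l : ℕ) : D.powCoeff 0 (D.mono m n l)
    = if m = D.N ∧ n = 0 ∧ l = 0 then 1 else 0 := by
  have h0 : D.toPoly 0 D.e12 = Polynomial.X := D.toPoly_x_self 0
  have h1 : D.toPoly 0 D.e23 = 0 := D.toPoly_x_ne (by decide)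
  simp only [powCoeff, LinearMap.comp_apply, AlgHom.toLinearMap_apply, mono, map_mul, map_pow,
    toPoly_e13, h0, h1]
  rcases n with _ | n <;> rcases l with _ | l <;> simp [Polynomial.coeff_X_pow, eq_comm]

lemma powCoeff_one_mono (m n l : ℕ) : D.powCoeff 1 (D.mono m n l)
    = if m = 0 ∧ n = 0 ∧ l = D.N then 1 else 0 := by
  have h0 : D.toPoly 1 D.e12 = 0 := D.toPoly_x_ne (by decide)
  have h1 : D.toPoly 1 D.e23 = Polynomial.X := D.toPoly_x_self 1
  simp only [powCoeff, LinearMap.comp_apply, AlgHom.toLinearMap_apply, mono, map_mul, map_pow,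
    toPoly_e13, h0, h1]
  rcases n with _ | n <;> rcases m with _ | m <;> simp [Polynomial.coeff_X_pow, eq_comm]

/-- The coefficient of `xᵢᴺ ⊗ xⱼᴺ`. -/
def powCoeff₂ (i j : Fin 2) : D.R ⊗[k] D.R →ₗ[k] k :=
  LinearMap.mul' k k ∘ₗ TensorProduct.map (D.powCoeff i) (D.powCoeff j)

lemma powCoeff₂_tmul (i j : Fin 2) (a b : D.R) :
    D.powCoeff₂ i j (a ⊗ₜ b) = D.powCoeff i a * D.powCoeff j b := rfl

/-- The automorphism of `k[X]` induced by the action of `g` on the powers of `xᵢ`. -/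
def polyAct (g : G) (i : Fin 2) : Polynomial k →ₐ[k] Polynomial k :=
  Polynomial.aeval ((D.χ i g : k) • Polynomial.X)

lemma toPoly_act (g : G) (i : Fin 2) (r : D.R) :
    D.toPoly i (D.act g r) = D.polyAct g i (D.toPoly i r) := by
  have : (D.toPoly i).comp (D.act g) = (D.polyAct g i).comp (D.toPoly i) := by
    refine D.algHom_ext_R fun j => ?_
    by_cases h : j = i
    · subst h
      simp [toPoly_x_self, polyAct]
    · simp [toPoly_x_ne _ h]
  exact congrArg (fun f => f r) this

/-- The tensor product of two of the maps `R(V) → k[X]`. -/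
abbrev toPoly₂ (i j : Fin 2) : D.R ⊗[k] D.R →ₗ[k] Polynomial k ⊗[k] Polynomial k :=
  TensorProduct.map (D.toPoly i).toLinearMap (D.toPoly j).toLinearMap

/-- Projecting the two tensor factors to polynomials in different generators kills one of the two
summands of xᵢ ⊗ 1 + 1 ⊗ xᵢ, so the image of Δ of a monomial is a single term. -/
lemma toPoly₂_primMul_left {i j : Fin 2} (h : i ≠ j) (w : D.R ⊗[k] D.R) :
    D.toPoly₂ i j (D.primMul i w)
      = TensorProduct.map (LinearMap.mulLeft k Polynomial.X) LinearMap.id (D.toPoly₂ i j w) := by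
  induction w with
  | zero => simp
  | add v w hv hw => simp only [map_add, hv, hw]
  | tmul a b => simp [toPoly_x_self, toPoly_x_ne _ h]

lemma toPoly₂_primMul_right {i j : Fin 2} (h : i ≠ j) (w : D.R ⊗[k] D.R) :
    D.toPoly₂ i j (D.primMul j w)
      = TensorProduct.map (D.polyAct (D.g j) i).toLinearMap (LinearMap.mulLeft k Polynomial.X)
        (D.toPoly₂ i j w) := by
  induction w with
  | zero => simp
  | add v w hv hw => simp only [map_add, hv, hw]
  | tmul a b => simp [toPoly_x_self, toPoly_x_ne _ h.symm, toPoly_act]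

open Polynomial in
-- Since `e13` maps to 0 in either polynomial ring, only the mixed term e₁₂ ⊗ e₂₃ survives. With the
-- two polynomial rings exchanged, it dies as well.
lemma toPoly₂_comulRep_e13 (w : D.R ⊗[k] D.R) :
    D.toPoly₂ 0 1 (D.comulRep D.e13 w)
      = (1 - D.q⁻¹) • TensorProduct.map (LinearMap.mulLeft k X ∘ₗ (D.polyAct (D.g 1) 0).toLinearMap)
        (LinearMap.mulLeft k X) (D.toPoly₂ 0 1 w) := by
  have h0 : D.toPoly 0 D.e12 = Polynomial.X := D.toPoly_x_self 0
  have h1 : D.toPoly 1 D.e23 = Polynomial.X := D.toPoly_x_self 1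
  rw [comulRep_e13]
  induction w with
  | zero => simp
  | add v w hv hw => rw [map_add, map_add, map_add, hv, hw, map_add, smul_add]
  | tmul a b => simp [toPoly_act, toPoly_e13, h0, h1]

lemma toPoly₂_comulRep_e13_swap (w : D.R ⊗[k] D.R) :
    D.toPoly₂ 1 0 (D.comulRep D.e13 w) = 0 := by
  have h0 : D.toPoly 1 D.e12 = 0 := D.toPoly_x_ne (by decide)
  rw [comulRep_e13]
  induction w with
  | zero => simp
  | add v w hv hw => rw [map_add, map_add, hv, hw, add_zero]
  | tmul a b => simp [toPoly_e13, h0]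

open Polynomial in
-- Each further factor e₁₃ contributes 1 - q⁻¹ and lets g₁ act on the power Xⁱ already present by qm
-- 1 0 ^ i. The exponents 0 + 1 + ... + (n - 1) add up to n choose 2.
lemma toPoly₂_comulR_mono (m n l : ℕ) : D.toPoly₂ 0 1 (D.comulR (D.mono m n l))
    = ((1 - D.q⁻¹) ^ n * D.qm 1 0 ^ n.choose 2) • (((X : k[X]) ^ (m + n)) ⊗ₜ[k] ((X : k[X]) ^ (n + l))) := by
  have e0 : D.comulRep D.e12 = D.primMul 0 := D.comulRep_x 0
  have e1 : D.comulRep D.e23 = D.primMul 1 := D.comulRep_x 1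
  have hl : ∀ l, D.toPoly₂ 0 1 ((D.comulRep D.e23 ^ l) (1 ⊗ₜ 1)) = (1 : k[X]) ⊗ₜ[k] ((X : k[X]) ^ l) := by
    intro l
    induction l with
    | zero => simp
    | succ l ih =>
      rw [pow_succ', Module.End.mul_apply, e1, toPoly₂_primMul_right _ (by decide), ← e1, ih]
      simp [pow_succ']
  have hn : ∀ n w, D.toPoly₂ 0 1 w = (1 : k[X]) ⊗ₜ[k] ((X : k[X]) ^ l) → D.toPoly₂ 0 1 ((D.comulRep D.e13 ^ n) w)
      = ((1 - D.q⁻¹) ^ n * D.qm 1 0 ^ n.choose 2) • (((X : k[X]) ^ n) ⊗ₜ[k] ((X : k[X]) ^ (n + l))) := by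
    intro n w hw
    induction n with
    | zero => simpa using hw
    | succ n ih =>
      have hX : D.polyAct (D.g 1) 0 (X ^ n) = D.qm 1 0 ^ n • X ^ n := by
        rw [polyAct, map_pow, aeval_X, _root_.smul_pow]
        rfl
      rw [pow_succ', Module.End.mul_apply, toPoly₂_comulRep_e13, ih, map_smul,
        TensorProduct.map_tmul, LinearMap.comp_apply, AlgHom.toLinearMap_apply, hX, map_smul,
        LinearMap.mulLeft_apply, LinearMap.mulLeft_apply, ← pow_succ', ← pow_succ',
        ← TensorProduct.smul_tmul', smul_smul, smul_smul, Nat.choose_succ_succ' n 1,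
        Nat.choose_one_right, add_right_comm]
      congr 1
      ring
  have hm : ∀ m w, D.toPoly₂ 0 1 w
        = ((1 - D.q⁻¹) ^ n * D.qm 1 0 ^ n.choose 2) • (((X : k[X]) ^ n) ⊗ₜ[k] ((X : k[X]) ^ (n + l))) →
      D.toPoly₂ 0 1 ((D.comulRep D.e12 ^ m) w)
        = ((1 - D.q⁻¹) ^ n * D.qm 1 0 ^ n.choose 2) • (((X : k[X]) ^ (m + n)) ⊗ₜ[k] ((X : k[X]) ^ (n + l))) := by
    intro m w hw
    induction m with
    | zero => simpa using hw
    | succ m ih =>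
      rw [pow_succ', Module.End.mul_apply, e0, toPoly₂_primMul_left _ (by decide), ← e0, ih,
        map_smul, TensorProduct.map_tmul, LinearMap.mulLeft_apply, ← pow_succ', add_right_comm]
      rfl
  rw [comulR_eq, mono, map_mul, map_mul, map_pow, map_pow, map_pow]
  exact hm m _ (hn n _ (hl l))

lemma powCoeff₂_eq (i j : Fin 2) (w : D.R ⊗[k] D.R) : D.powCoeff₂ i j w
    = LinearMap.mul' k k (TensorProduct.map (Polynomial.lcoeff k D.N) (Polynomial.lcoeff k D.N)
      (D.toPoly₂ i j w)) := by
  induction w with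
  | zero => simp
  | add v w hv hw => simp only [map_add, hv, hw]
  | tmul a b => rfl

lemma powCoeff₂_comulR_mono (m n l : ℕ) : D.powCoeff₂ 0 1 (D.comulR (D.mono m n l))
    = if m = l ∧ m + n = D.N then (1 - D.q⁻¹) ^ n * D.qm 1 0 ^ n.choose 2 else 0 := by
  rw [powCoeff₂_eq, toPoly₂_comulR_mono, map_smul, map_smul, TensorProduct.map_tmul,
    LinearMap.mul'_apply, Polynomial.lcoeff_apply, Polynomial.lcoeff_apply, Polynomial.coeff_X_pow,
    Polynomial.coeff_X_pow]
  have h : (m = l ∧ m + n = D.N) ↔ (D.N = m + n ∧ D.N = n + l) := by omega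
  rw [ite_cond_congr (propext h), ite_and, smul_eq_mul]
  split_ifs <;> simp

/-- For n = 0 the degree m in x₀ is below N, so x₀ᴺ cannot occur. For n > 0 a factor Δ(e₁₃) is
killed by the projection. -/
lemma powCoeff₂_comulR_mono_swap {m n l : ℕ} (hm : m < D.N) :
    D.powCoeff₂ 1 0 (D.comulR (D.mono m n l)) = 0 := by
  cases n with
  | zero =>
    have h : ∀ w ∈ D.tensorDeg (m + 0) (0 + l), D.powCoeff₂ 1 0 w = 0 := by
      intro w hw
      induction hw using Submodule.span_induction with
      | mem w hw =>
        obtain ⟨m₁, n₁, l₁, m₂, n₂, l₂, h1, h2, rfl⟩ := hw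
        rw [powCoeff₂_tmul, powCoeff_zero_mono, if_neg (by omega), mul_zero]
      | zero => rw [map_zero]
      | add v w _ _ hv hw => rw [map_add, hv, hw, add_zero]
      | smul c w _ hw => rw [map_smul, hw, smul_zero]
    exact h _ (comulR_mono_mem m 0 l)
  | succ n =>
    have h : ∀ w, D.toPoly₂ 1 0 w = 0 → ∀ m, D.toPoly₂ 1 0 ((D.comulRep D.e12 ^ m) w) = 0 := by
      intro w hw m
      have e0 : D.comulRep D.e12 = D.primMul 0 := D.comulRep_x 0
      induction m with
      | zero => simpa using hw
      | succ m ih =>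
        rw [pow_succ', Module.End.mul_apply, e0, toPoly₂_primMul_right _ (by decide), ← e0, ih,
          map_zero]
    rw [powCoeff₂_eq, comulR_eq, mono, map_mul, map_mul, map_pow, map_pow, map_pow,
      pow_succ' (D.comulRep D.e13), Module.End.mul_apply, Module.End.mul_apply,
      Module.End.mul_apply, h _ (D.toPoly₂_comulRep_e13_swap _), map_zero, map_zero]

end DiagramA2

/-! ### Compatibility with the comultiplication. -/

namespace DiagramA2

variable {k G : Type*} [Field k] [CommGroup G] {D : DiagramA2 k G} {u : D.R →ₗ[k] D.K}

/-- The linear endomorphism of `R(V)` given by a deformed retraction. -/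
abbrev inclComp (u : D.R →ₗ[k] D.K) : D.R →ₗ[k] D.R := D.K.val.toLinearMap ∘ₗ u

lemma one_sub_inv_q_ne_zero : 1 - D.q⁻¹ ≠ 0 := by
  intro h
  have h1 : D.q = 1 := by rw [← inv_eq_one, ← sub_eq_zero.mp h]
  exact D.q_primitive.ne_one D.two_le_N h1

/-- This equation dictates the coefficient of the deformation: times the mixed coefficient of
Δ(z₁₃), it must give the coefficient of x₀ᴺ ⊗ x₁ᴺ in Δ of the monomial. -/
lemma defCoeff_mul (m n l : ℕ) :
    D.defCoeff m n l * ((1 - D.q⁻¹) ^ D.N * D.qm 1 0 ^ D.N.choose 2)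
      = D.powCoeff₂ 0 1 (D.comulR (D.mono m n l)) := by
  have ht := one_sub_inv_q_ne_zero (D := D)
  have hr := D.qm_ne_zero 1 0
  rw [powCoeff₂_comulR_mono, defCoeff]
  split_ifs
  · rw [zpow_sub₀ ht, zpow_sub₀ hr]
    simp only [zpow_natCast]
    field_simp
  · rw [zero_mul]

namespace IsDeformedRetraction

/-- Factor off the part in `K`, whose bidegree is a multiple of N. On the restricted part the map is
nonzero only in bidegree (0, 0) or (N, N). -/
lemma apply_mono_eq_zero (hu : D.IsDeformedRetraction u) {m n l : ℕ}
    (h : ¬ (D.N ∣ m + n ∧ D.N ∣ n + l)) : (u (D.mono m n l) : D.R) = 0 := by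
  have h1 := D.mono_mul_zmono (m % D.N) (n % D.N) (l % D.N) (m / D.N) (n / D.N) (l / D.N)
  simp only [Nat.mod_add_div'] at h1
  rw [← inv_smul_eq_iff₀ (D.rho_ne_zero _)] at h1
  rw [← h1, map_smul, Subalgebra.coe_smul, hu.apply_mono_mul (Nat.mod_lt m D.N_pos)
    (Nat.mod_lt n D.N_pos) (Nat.mod_lt l D.N_pos) (Subtype.property _)]
  have h2 : ¬ (D.N ∣ m % D.N + n % D.N ∧ D.N ∣ n % D.N + l % D.N) := by
    simpa only [Nat.dvd_iff_mod_eq_zero, Nat.mod_add_mod, Nat.add_mod_mod] using h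
  rw [counitHom_mono, defCoeff, if_neg, if_neg, zero_smul, zero_smul, add_zero, smul_zero]
  · rintro ⟨h3, h4⟩
    exact h2 ⟨dvd_of_eq h4.symm, by rw [add_comm, ← h3, h4]⟩
  · rintro ⟨h3, h4, h5⟩
    exact h2 ⟨by rw [h3, h4]; exact dvd_zero _, by rw [h4, h5]; exact dvd_zero _⟩

/-- If both values are nonzero and neither monomial is 1, the degrees are multiples of N with sums
below 2N, which leaves only the bidegrees (N, 0) and (0, N) in either order. Bidegree zero is
excluded since 1 ⊗ 1 would be counted by both counit terms. -/
lemma apply_tmul (hu : D.IsDeformedRetraction u) {m n l m' n' l' : ℕ}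
    (h1 : m + n + (m' + n') < 2 * D.N) (h2 : n + l + (n' + l') < 2 * D.N)
    (h0 : ¬ (m + n + (m' + n') = 0 ∧ n + l + (n' + l') = 0)) :
    (u (D.mono m n l) : D.R) ⊗ₜ[k] (u (D.mono m' n' l') : D.R)
      = D.counitHom (D.mono m n l) • (1 ⊗ₜ (u (D.mono m' n' l') : D.R))
        + D.counitHom (D.mono m' n' l') • ((u (D.mono m n l) : D.R) ⊗ₜ 1)
        + D.powCoeff₂ 0 1 (D.mono m n l ⊗ₜ D.mono m' n' l') • (D.e12 ^ D.N) ⊗ₜ (D.e23 ^ D.N)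
        + D.powCoeff₂ 1 0 (D.mono m n l ⊗ₜ D.mono m' n' l')
          • (D.e23 ^ D.N) ⊗ₜ (D.e12 ^ D.N) := by
  have hN := D.N_pos
  have hu1 : (u 1 : D.R) = 1 := hu.apply_coe (one_mem _)
  have hu12 : (u (D.mono D.N 0 0) : D.R) = D.e12 ^ D.N := by
    simpa [mono] using hu.apply_coe D.z12_mem
  have hu23 : (u (D.mono 0 0 D.N) : D.R) = D.e23 ^ D.N := by
    simpa [mono] using hu.apply_coe D.z23_mem
  simp only [powCoeff₂_tmul, powCoeff_zero_mono, powCoeff_one_mono, counitHom_mono]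
  by_cases ha : m = 0 ∧ n = 0 ∧ l = 0
  · obtain ⟨rfl, rfl, rfl⟩ := ha
    have hb : ¬ (m' = 0 ∧ n' = 0 ∧ l' = 0) := by omega
    simp [hb, hu1, hN.ne]
  by_cases hb : m' = 0 ∧ n' = 0 ∧ l' = 0
  · obtain ⟨rfl, rfl, rfl⟩ := hb
    simp [ha, hu1, hN.ne]
  rw [if_neg ha, if_neg hb, zero_smul, zero_smul, zero_add, zero_add]
  by_cases hc : D.N ∣ m + n ∧ D.N ∣ n + l
  swap
  · rw [hu.apply_mono_eq_zero hc, TensorProduct.zero_tmul, if_neg (c := m = D.N ∧ _),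
      if_neg (c := m = 0 ∧ _)]
    · simp
    · rintro ⟨rfl, rfl, rfl⟩
      simp at hc
    · rintro ⟨rfl, rfl, rfl⟩
      simp at hc
  by_cases hd : D.N ∣ m' + n' ∧ D.N ∣ n' + l'
  swap
  · rw [hu.apply_mono_eq_zero hd, TensorProduct.tmul_zero, if_neg (c := m' = 0 ∧ _),
      if_neg (c := m' = D.N ∧ _)]
    · simp
    · rintro ⟨rfl, rfl, rfl⟩
      simp at hd
    · rintro ⟨rfl, rfl, rfl⟩
      simp at hd
  have key : ∀ a, D.N ∣ a → a < 2 * D.N → a = 0 ∨ a = D.N := by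
    rintro _ ⟨c, rfl⟩ h
    have : c < 2 := lt_of_mul_lt_mul_left (by rwa [mul_comm 2] at h) hN.le
    interval_cases c <;> simp
  have k1 := key _ hc.1 (by omega)
  have k2 := key _ hc.2 (by omega)
  have k3 := key _ hd.1 (by omega)
  have k4 := key _ hd.2 (by omega)
  -- Each degree is 0 or N, and at most one factor can have degree N in a given generator. As
  -- neither factor is trivial, each takes exactly one generator, which forces n = n' = 0.
  have hcase : (m = D.N ∧ n = 0 ∧ l = 0 ∧ m' = 0 ∧ n' = 0 ∧ l' = D.N)
      ∨ (m = 0 ∧ n = 0 ∧ l = D.N ∧ m' = D.N ∧ n' = 0 ∧ l' = 0) := by omega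
  rcases hcase with ⟨rfl, rfl, rfl, rfl, rfl, rfl⟩ | ⟨rfl, rfl, rfl, rfl, rfl, rfl⟩
  · simp [hu12, hu23, hN.ne']
  · simp [hu12, hu23, hN.ne']

lemma map_mem_tensorDeg (hu : D.IsDeformedRetraction u) {α β : ℕ} (h1 : α < 2 * D.N)
    (h2 : β < 2 * D.N) (h0 : ¬ (α = 0 ∧ β = 0)) {w : D.R ⊗[k] D.R} (hw : w ∈ D.tensorDeg α β) :
    TensorProduct.map (inclComp u) (inclComp u) w
      = TensorProduct.map (Algebra.linearMap k D.R) (inclComp u)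
          (D.counitHom.toLinearMap.rTensor D.R w)
        + TensorProduct.map (inclComp u) (Algebra.linearMap k D.R)
          (D.counitHom.toLinearMap.lTensor D.R w)
        + D.powCoeff₂ 0 1 w • (D.e12 ^ D.N) ⊗ₜ (D.e23 ^ D.N)
        + D.powCoeff₂ 1 0 w • (D.e23 ^ D.N) ⊗ₜ (D.e12 ^ D.N) := by
  induction hw using Submodule.span_induction with
  | mem w hw =>
    obtain ⟨m, n, l, m', n', l', rfl, rfl, rfl⟩ := hw
    have h := hu.apply_tmul h1 h2 h0
    simp only [TensorProduct.map_tmul, LinearMap.rTensor_tmul, LinearMap.lTensor_tmul,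
      LinearMap.comp_apply, AlgHom.toLinearMap_apply, Subalgebra.coe_val,
      Algebra.linearMap_apply, Algebra.algebraMap_eq_smul_one, TensorProduct.tmul_smul,
      ← TensorProduct.smul_tmul']
    exact h
  | zero => simp
  | add v w _ _ hv hw =>
    simp only [map_add, hv, hw]
    module
  | smul c w _ hw =>
    simp only [map_smul, hw, smul_eq_mul]
    module

/-- Exponents below N give bidegree below (2N, 2N), so the formula for u ⊗ u applies to Δ(e). Its
counit terms give u(e) ⊗ 1 and 1 ⊗ u(e), and its mixed term is that of the multiple of Δ(z₁₃) by
`defCoeff_mul`. -/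
lemma comulR_apply_mono (hu : D.IsDeformedRetraction u) {m n l : ℕ} (hm : m < D.N) (hn : n < D.N)
    (hl : l < D.N) : D.comulR (u (D.mono m n l))
      = TensorProduct.map (inclComp u) (inclComp u) (D.comulR (D.mono m n l)) := by
  have h1 : (u 1 : D.R) = 1 := hu.apply_coe (one_mem _)
  by_cases h0 : m = 0 ∧ n = 0 ∧ l = 0
  · obtain ⟨rfl, rfl, rfl⟩ := h0
    simp [h1, comulR_one]
  have hc1 : D.counitHom.toLinearMap.rTensor D.R (D.comulR (D.mono m n l)) = 1 ⊗ₜ D.mono m n l :=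
    Coalgebra.rTensor_counit_comul (R := k) (D.mono m n l)
  have hc2 : D.counitHom.toLinearMap.lTensor D.R (D.comulR (D.mono m n l)) = D.mono m n l ⊗ₜ 1 :=
    Coalgebra.lTensor_counit_comul (R := k) (D.mono m n l)
  have hv := hu.apply_mono_mul hm hn hl (one_mem D.K)
  rw [mul_one, counitHom_mono, if_neg h0, zero_smul, zero_add, mul_one] at hv
  rw [hu.map_mem_tensorDeg (by omega) (by omega) (by omega) (comulR_mono_mem m n l), hc1, hc2,
    powCoeff₂_comulR_mono_swap D hm, ← defCoeff_mul, TensorProduct.map_tmul,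
    TensorProduct.map_tmul, LinearMap.comp_apply, AlgHom.toLinearMap_apply, Subalgebra.coe_val, hv,
    map_smul, comulR_z13, Algebra.linearMap_apply, map_one, TensorProduct.tmul_smul,
    ← TensorProduct.smul_tmul']
  module

/-- For a generator z of `K`, the operator of Δ(z) is built from left multiplications by elements of
`K` and the action of G, and u commutes with all of these. -/
lemma map_comulRep (hu : D.IsDeformedRetraction u) {z : D.R} (hz : z ∈ D.K) (w : D.R ⊗[k] D.R) :
    TensorProduct.map (inclComp u) (inclComp u) (D.comulRep z w)
      = D.comulRep z (TensorProduct.map (inclComp u) (inclComp u) w) := by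
  have key : ∀ f g : D.R →ₗ[k] D.R, (∀ r, inclComp u (f r) = f (inclComp u r)) →
      (∀ r, inclComp u (g r) = g (inclComp u r)) → ∀ w,
      TensorProduct.map (inclComp u) (inclComp u) (TensorProduct.map f g w)
        = TensorProduct.map f g (TensorProduct.map (inclComp u) (inclComp u) w) := by
    intro f g hf hg w
    induction w with
    | zero => simp
    | add v w hv hw => simp only [map_add, hv, hw]
    | tmul a b => simp only [TensorProduct.map_tmul, hf, hg]
  have hx : ∀ i, D.x i ^ D.N ∈ D.K → ∀ w,
      TensorProduct.map (inclComp u) (inclComp u) (D.comulRep (D.x i ^ D.N) w)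
      = D.comulRep (D.x i ^ D.N) (TensorProduct.map (inclComp u) (inclComp u) w) := by
    intro i hi w
    rw [comulRep_x_pow, LinearMap.add_apply, map_add, LinearMap.add_apply,
      key (LinearMap.mulLeft k _) LinearMap.id (fun r => hu.apply_coe_mul hi r) (fun r => rfl),
      key (D.act _).toLinearMap (LinearMap.mulLeft k _) (fun r => hu.apply_act _ r)
        (fun r => hu.apply_coe_mul hi r)]
  induction hz using Algebra.adjoin_induction generalizing w with
  | mem y hy =>
    rcases hy with rfl | rfl | rfl
    · exact hx 0 D.z12_mem w
    · rw [comulRep_z13]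
      simp only [LinearMap.add_apply, map_add, LinearMap.smul_apply, map_smul]
      rw [key (LinearMap.mulLeft k _) LinearMap.id (fun r => hu.apply_coe_mul D.z13_mem r)
          (fun r => rfl),
        key (D.act _).toLinearMap (LinearMap.mulLeft k _) (fun r => hu.apply_act _ r)
          (fun r => hu.apply_coe_mul D.z13_mem r),
        key (LinearMap.mulLeft k _ * (D.act _).toLinearMap) (LinearMap.mulLeft k _) (fun r => ?_)
          (fun r => hu.apply_coe_mul D.z23_mem r)]
      exact (hu.apply_coe_mul D.z12_mem _).trans (congrArg _ (hu.apply_act _ r))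
    · exact hx 1 D.z23_mem w
  | algebraMap c =>
    rw [AlgHom.commutes, Module.algebraMap_end_apply, Module.algebraMap_end_apply, map_smul]
  | add y z _ _ hy hz => simp only [map_add, LinearMap.add_apply, hy, hz]
  | mul y z _ _ hy hz => simp only [map_mul, Module.End.mul_apply, hy, hz]

lemma comulR_apply (hu : D.IsDeformedRetraction u) (r : D.R) :
    D.comulR (u r) = TensorProduct.map (inclComp u) (inclComp u) (D.comulR r) := by
  -- The factor from `K` is placed on the left because Δ(z r) is obtained from Δ(r) by the operator
  -- of Δ(z).
  induction r using D.restricted_induction_left with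
  | add a b ha hb => simp only [map_add, Subalgebra.coe_add, ha, hb]
  | smul c a ha => simp only [map_smul, Subalgebra.coe_smul, ha]
  | mul_mono m n l hm hn hl z hz =>
    rw [hu.apply_coe_mul hz, comulR_mul_eq, comulR_mul_eq, hu.map_comulRep hz,
      hu.comulR_apply_mono hm hn hl]

lemma isBimoduleCoalgebraRetraction (hu : D.IsDeformedRetraction u) :
    BraidedHopfAlgebra.IsBimoduleCoalgebraRetraction D.isHopfSubalgebra_K u where
  map_incl z := Subtype.ext (hu.apply_coe z.2)
  map_mul_left z r := Subtype.ext (hu.apply_coe_mul z.2 r)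
  map_mul_right z r := Subtype.ext (hu.apply_mul_coe z.2 r)
  map_comul r := by
    apply BraidedHopfAlgebra.inclTensor_injective D.K
    refine (D.isHopfSubalgebra_K.inclTensor_comul (u r)).trans ?_
    have h : BraidedHopfAlgebra.inclTensor D.K ∘ₗ TensorProduct.map u u
        = TensorProduct.map (inclComp u) (inclComp u) := (TensorProduct.map_comp _ _ _ _).symm
    exact (hu.comulR_apply r).trans (LinearMap.congr_fun h (D.comulR r)).symm
  map_counit r := hu.counitHom_apply r
  map_act h r := hu.apply_act h r
  map_coact r := hu.coact_apply r

end IsDeformedRetraction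

end DiagramA2

end

theorem proposition3p8 {k G : Type*} [Field k] [CommGroup G] (D : DiagramA2 k G) :
    ∃ hK : D.hopf.IsHopfSubalgebra D.K,
      (∃! u : D.R →ₗ[k] D.K, D.IsDeformedRetraction u) ∧
      ∀ u : D.R →ₗ[k] D.K, D.IsDeformedRetraction u →
        BraidedHopfAlgebra.IsBimoduleCoalgebraRetraction hK u :=
  ⟨D.isHopfSubalgebra_K, D.existsUnique_isDeformedRetraction,
    fun _ hu => hu.isBimoduleCoalgebraRetraction⟩
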